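/- All logarithms are to base $2$. For a finite undirected unweighted graph $G=(V,E)$ on $n$ nodes and a non-empty set $S\subseteq V$ put $\Phi_G(S)=|\mathrm{cut}_G(S)|/\mathrm{vol}_G(S)$, where $\mathrm{cut}_G(S)$ is the set of edges with exactly one end-point in $S$ and $\mathrm{vol}_G(S)$ is the sum of the degrees of the nodes of $S$ (so $\Phi_G(S)=|\mathrm{cut}_G(S)|/(d|S|)$ if $G$ is $d$-regular). The graph $G$ is $\delta$-hyperbolic if for every three nodes $u,v,w$ and all shortest paths $\overline{u,v}$, $\overline{u,w}$, $\overline{v,w}$ between them, every node of $\overline{u,v}$ is at distance at most $\delta$ from some node of $\overline{u,w}$ or $\overline{v,w}$. There is a universal constant $\eta>0$ such that for all constants $0<\rho<1/3$, $0<\zeta<1/2$ and $0<\varepsilon\le 1$ there are a deterministic algorithm $A$ (a program of a random access machine whose arithmetic operations are addition and truncated subtraction, each at unit cost) and a polynomial $P$ with the following property. Let $G$ be a connected $d$-regular $\delta$-hyperbolic graph on $n$ nodes with $$d\le 2^{(\log n)^{1/3-\rho}}\qquad\text{and}\qquad \delta\le(\log n)^{\rho},$$ and suppose that there is a non-empty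 set $S$ of at most $\zeta n$ nodes of $G$ with $\Phi_G(S)\le\varepsilon$. Then $A$, given the adjacency matrix of $G$, halts after at most $P(n)$ steps and outputs a non-empty set $S'$ of at most $\zeta n$ nodes of $G$ with $\Phi_G(S')\le\eta\,\varepsilon$. -/

import Mathlib

/-! ### Graph notions -/

/-- `G` is `δ`-hyperbolic (thin geodesic triangles): for all shortest paths `puv`, `puw`, `pvw`
between three nodes, every node of `puv` is within distance `δ` of a node of `puw` or `pvw`.
(A walk whose length is the distance of its ends is the same thing as a shortest path.) -/
def IsHyperbolic {V : Type*} (G : SimpleGraph V) (δ : ℝ) : Prop :=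
  ∀ (u v w : V) (puv : G.Walk u v) (puw : G.Walk u w) (pvw : G.Walk v w),
    puv.length = G.dist u v → puw.length = G.dist u w → pvw.length = G.dist v w →
    ∀ x ∈ puv.support, ∃ y, (y ∈ puw.support ∨ y ∈ pvw.support) ∧ (G.dist x y : ℝ) ≤ δ

section Expansion

variable {V : Type*} [Fintype V] [DecidableEq V]

/-- The number of edges of `G` with exactly one end in `S` (each such edge is counted once, as the
pair of its end inside `S` and its end outside `S`). -/
def cutSize (G : SimpleGraph V) [DecidableRel G.Adj] (S : Finset V) : ℕ :=
  (G.interedges S Sᶜ).card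

/-- The volume of `S`: the sum of the degrees of the nodes of `S`. -/
def vol (G : SimpleGraph V) [DecidableRel G.Adj] (S : Finset V) : ℕ :=
  ∑ v ∈ S, G.degree v

/-- The normalized edge expansion `|cut(S)| / vol(S)`. -/
noncomputable def normExpansion (G : SimpleGraph V) [DecidableRel G.Adj] (S : Finset V) : ℝ :=
  (cutSize G S : ℝ) / (vol G S : ℝ)

/-- `S` is a non-empty set of at most `ζ |V|` nodes with normalized expansion at most `ε`. -/
def IsSmallNonexpanding (G : SimpleGraph V) [DecidableRel G.Adj] (ζ ε : ℝ) (S : Finset V) : Prop :=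
  S.Nonempty ∧ (S.card : ℝ) ≤ ζ * (Fintype.card V : ℝ) ∧ normExpansion G S ≤ ε

end Expansion

/-! ### The machine model

A random access machine over the natural numbers, programmed with assignments, branching and
`while` loops.  A fixed program mentions finitely many registers and finitely many arrays.  The
arithmetic operations are addition and truncated subtraction (no multiplication), so that the
bit length of the numbers grows by `O(1)` per step and the unit-cost running time agrees with
Turing machine time up to a polynomial. -/

namespace RAM

/-- A memory state: the contents of the registers and of the arrays. -/
structure State where
  reg : ℕ → ℕ
  arr : ℕ → ℕ → ℕ

/-- Expressions: constants, registers, array access, addition, truncated subtraction. -/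
inductive Expr where
  | const (c : ℕ)
  | reg (x : ℕ)
  | get (a : ℕ) (i : Expr)
  | add (e f : Expr)
  | sub (e f : Expr)

/-- The value of an expression. -/
def Expr.eval (s : State) : Expr → ℕ
  | .const c => c
  | .reg x => s.reg x
  | .get a i => s.arr a (i.eval s)
  | .add e f => e.eval s + f.eval s
  | .sub e f => e.eval s - f.eval s

/-- The number of steps for evaluating an expression: one for each of its nodes. -/
def Expr.cost : Expr → ℕ
  | .const _ => 1
  | .reg _ => 1
  | .get _ i => i.cost + 1
  | .add e f => e.cost + f.cost + 1
  | .sub e f => e.cost + f.cost + 1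

/-- Programs. A condition is an expression; it holds when its value is not zero. -/
inductive Program where
  | skip
  | assign (x : ℕ) (e : Expr)
  | store (a : ℕ) (i e : Expr)
  | seq (p q : Program)
  | ite (e : Expr) (p q : Program)
  | loop (e : Expr) (p : Program)

/-- `Exec p s t s'`: started in the state `s`, the program `p` halts after exactly `t` steps, in
the state `s'`. -/
inductive Exec : Program → State → ℕ → State → Prop where
  | skip (s : State) : Exec .skip s 1 s
  | assign (x : ℕ) (e : Expr) (s : State) :
      Exec (.assign x e) s (e.cost + 1) ⟨Function.update s.reg x (e.eval s), s.arr⟩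
  | store (a : ℕ) (i e : Expr) (s : State) :
      Exec (.store a i e) s (i.cost + e.cost + 1)
        ⟨s.reg, Function.update s.arr a (Function.update (s.arr a) (i.eval s) (e.eval s))⟩
  | seq {p q : Program} {s s' s'' : State} {t t' : ℕ} :
      Exec p s t s' → Exec q s' t' s'' → Exec (.seq p q) s (t + t') s''
  | ite_true {e : Expr} {p q : Program} {s s' : State} {t : ℕ} :
      e.eval s ≠ 0 → Exec p s t s' → Exec (.ite e p q) s (e.cost + 1 + t) s'
  | ite_false {e : Expr} {p q : Program} {s s' : State} {t : ℕ} :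
      e.eval s = 0 → Exec q s t s' → Exec (.ite e p q) s (e.cost + 1 + t) s'
  | loop_done {e : Expr} {p : Program} {s : State} :
      e.eval s = 0 → Exec (.loop e p) s (e.cost + 1) s
  | loop_step {e : Expr} {p : Program} {s s' s'' : State} {t t' : ℕ} :
      e.eval s ≠ 0 → Exec p s t s' → Exec (.loop e p) s' t' s'' →
        Exec (.loop e p) s (e.cost + 1 + t + t') s''

/-- The input: register `0` holds the number `n` of nodes, array `0` holds the adjacency matrix
row by row; everything else is zero. -/
def input {n : ℕ} (G : SimpleGraph (Fin n)) [DecidableRel G.Adj] : State where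
  reg x := if x = 0 then n else 0
  arr a k :=
    if a = 0 ∧ ∃ i j : Fin n, G.Adj i j ∧ k = (i : ℕ) * n + (j : ℕ) then 1 else 0

/-- The output, a set of nodes: array `1` holds its indicator function. -/
def output (n : ℕ) (s : State) : Finset (Fin n) :=
  Finset.univ.filter fun i => s.arr 1 (i : ℕ) ≠ 0

end RAM

/-!
On a shortest path between two nodes at distance about `log n / log (d + 1)`, mark `2K + 1` equally
spaced nodes, remove the balls of radius `r` around the even ones, and search from each odd one
between the two neighbouring balls. By thinness of triangles, a search that gets around a ball needs
`2 ^ N` rounds, where `r` is about `δ N`; with fewer rounds the `K` searches are disjoint, and one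
of them stays below `n / K` nodes. As long as the cut of a search is large, the search grows by a
constant factor per round: first because it has not reached the balls, and later because it is so
much larger than them that they obstruct only a small part of its boundary. Since it cannot outgrow
`n` within `O(log n)` rounds, some round has a small cut.

All this fits into the diameter as soon as `n` is large, whatever the value of `ε`. The algorithm
tries all the searches, given by the centers and the radius of two balls, the starting node and the
number of rounds; the finitely many small graphs are treated by a table.
-/

namespace HyperbolicCut

open Finset

section Geodesics

variable {V : Type*} {G : SimpleGraph V} {δ : ℝ}

/-- `x` lies on some shortest path from `u` to `v`. -/
def OnGeodesic (G : SimpleGraph V) (u x v : V) : Prop :=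
  G.dist u x + G.dist x v = G.dist u v

theorem OnGeodesic.symm {u x v : V} (h : OnGeodesic G u x v) : OnGeodesic G v x u := by
  unfold OnGeodesic at *
  rw [G.dist_comm (u := v) (v := x), G.dist_comm (u := x) (v := u), add_comm, h, G.dist_comm]

theorem onGeodesic_of_mem_support (hG : G.Connected) {u v x : V} {p : G.Walk u v}
    (hp : p.length = G.dist u v) (hx : x ∈ p.support) : OnGeodesic G u x v := by
  classical
  refine le_antisymm ?_ hG.dist_triangle
  calc G.dist u x + G.dist x v
      ≤ (p.takeUntil x hx).length + (p.dropUntil x hx).length :=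
        add_le_add (SimpleGraph.dist_le _) (SimpleGraph.dist_le _)
    _ = G.dist u v := by rw [← SimpleGraph.Walk.length_append, p.take_spec hx, hp]

theorem exists_near_side (hG : G.Connected) (hδ : IsHyperbolic G δ) {u v x : V}
    (hx : OnGeodesic G u x v) (w : V) :
    ∃ y, (OnGeodesic G u y w ∨ OnGeodesic G v y w) ∧ (G.dist x y : ℝ) ≤ δ := by
  obtain ⟨p, hp⟩ := hG.exists_walk_length_eq_dist u x
  obtain ⟨p', hp'⟩ := hG.exists_walk_length_eq_dist x v
  obtain ⟨q, hq⟩ := hG.exists_walk_length_eq_dist u w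
  obtain ⟨q', hq'⟩ := hG.exists_walk_length_eq_dist v w
  have hpp' : (p.append p').length = G.dist u v := by
    rw [SimpleGraph.Walk.length_append, hp, hp', hx]
  obtain ⟨y, hy, hxy⟩ := hδ u v w (p.append p') q q' hpp' hq hq' x (by simp)
  exact ⟨y, hy.imp (onGeodesic_of_mem_support hG hq) (onGeodesic_of_mem_support hG hq'), hxy⟩

theorem nonneg_of_isHyperbolic (hG : G.Connected) (hδ : IsHyperbolic G δ) : 0 ≤ δ := by
  obtain ⟨v⟩ := hG.nonempty
  have hv : OnGeodesic G v v v := by simp [OnGeodesic]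
  obtain ⟨y, -, hy⟩ := exists_near_side hG hδ hv v
  exact (Nat.cast_nonneg _).trans hy

theorem cast_dist_le_add (hG : G.Connected) (u v w : V) :
    (G.dist u w : ℝ) ≤ G.dist u v + G.dist v w := mod_cast hG.dist_triangle

theorem exists_near_seq (hG : G.Connected) (hδ : IsHyperbolic G δ) (N : ℕ) {f : ℕ → V} {x : V}
    (hf : ∀ i, G.dist (f i) (f (i + 1)) ≤ 1) (hx : OnGeodesic G (f 0) x (f (2 ^ N))) :
    ∃ i, (G.dist x (f i) : ℝ) ≤ δ * N := by
  induction N generalizing f x with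
  | zero =>
    have hx_end : G.dist x (f 0) = 0 ∨ G.dist x (f 1) = 0 := by
      have h01 := hf 0
      simp only [OnGeodesic, G.dist_comm (u := (f 0)) (v := x), pow_zero, zero_add] at hx h01
      omega
    rcases hx_end with h | h
    · exact ⟨0, by simp [h]⟩
    · exact ⟨1, by simp [h]⟩
  | succ N ih =>
    suffices ∃ y, (∃ i, (G.dist y (f i) : ℝ) ≤ δ * N) ∧ (G.dist x y : ℝ) ≤ δ by
      obtain ⟨y, ⟨i, hyi⟩, hxy⟩ := this
      refine ⟨i, ?_⟩
      push_cast
      linarith [cast_dist_le_add hG x y (f i)]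
    obtain ⟨y, hy | hy, hxy⟩ := exists_near_side hG hδ hx (f (2 ^ N))
    · exact ⟨y, ih hf hy, hxy⟩
    · have hy' : OnGeodesic G (f (2 ^ N + 0)) y (f (2 ^ N + 2 ^ N)) := by
        rw [← mul_two, ← pow_succ]
        exact hy.symm
      obtain ⟨i, hi⟩ := ih (f := fun i => f (2 ^ N + i)) (fun i => hf (2 ^ N + i)) hy'
      exact ⟨y, ⟨2 ^ N + i, hi⟩, hxy⟩

theorem exists_near_or_exists_near (hG : G.Connected) (hδ : IsHyperbolic G δ) {p b a q : V}
    (h : G.dist p b + G.dist b a + G.dist a q = G.dist p q) (z : V) :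
    (∃ y, OnGeodesic G p y z ∧ (G.dist b y : ℝ) ≤ 3 * δ) ∨
      ∃ y, OnGeodesic G q y z ∧ (G.dist a y : ℝ) ≤ 3 * δ := by
  have hδ₀ := nonneg_of_isHyperbolic hG hδ
  have hb : OnGeodesic G p b q := by
    have := hG.dist_triangle (u := b) (v := a) (w := q)
    have := hG.dist_triangle (u := p) (v := b) (w := q)
    unfold OnGeodesic
    omega
  have ha : OnGeodesic G p a q := by
    have := hG.dist_triangle (u := p) (v := b) (w := a)
    have := hG.dist_triangle (u := p) (v := a) (w := q)
    unfold OnGeodesic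
    omega
  obtain ⟨y, hy | hy, hby⟩ := exists_near_side hG hδ hb z
  · exact Or.inl ⟨y, hy, by linarith⟩
  obtain ⟨y', hy' | hy', hay'⟩ := exists_near_side hG hδ ha z
  swap
  · exact Or.inr ⟨y', hy', by linarith⟩
  -- The sides through `y` and `y'` cross over, which is possible only if `a` and `b` are close.
  have hba : (G.dist b a : ℝ) ≤ 2 * δ := by
    have hpqR : (G.dist p b + G.dist b a + G.dist a q : ℝ) = G.dist p q := mod_cast h
    have hyR : (G.dist q y + G.dist y z : ℝ) = G.dist q z := mod_cast hy
    have hyR' : (G.dist p y' + G.dist y' z : ℝ) = G.dist p z := mod_cast hy'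
    have hbR : (G.dist p b + G.dist b q : ℝ) = G.dist p q := mod_cast hb
    have haR : (G.dist p a + G.dist a q : ℝ) = G.dist p q := mod_cast ha
    have hpz := cast_dist_le_add hG p b z
    have hbz := cast_dist_le_add hG b y z
    have hqz := cast_dist_le_add hG q a z
    have haz := cast_dist_le_add hG a y' z
    have hpa := cast_dist_le_add hG p y' a
    have hqb := cast_dist_le_add hG q y b
    rw [G.dist_comm (u := q) (v := a)] at hqz
    rw [G.dist_comm (u := y') (v := a)] at hpa
    rw [G.dist_comm (u := y) (v := b), G.dist_comm (u := q) (v := b)] at hqb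
    linarith
  exact Or.inl ⟨y', hy', by linarith [cast_dist_le_add hG b a y']⟩

theorem dist_getVert {u v : V} {p : G.Walk u v} (hp : p.length = G.dist u v) {i j : ℕ}
    (hij : i ≤ j) (hj : j ≤ p.length) : G.dist (p.getVert i) (p.getVert j) = j - i := by
  have h := SimpleGraph.length_eq_dist_of_subwalk hp
    (((p.drop i).isSubwalk_take (j - i)).trans (p.isSubwalk_drop i))
  rw [SimpleGraph.Walk.take_length, SimpleGraph.Walk.drop_length, min_eq_left (by omega),
    SimpleGraph.Walk.drop_getVert, Nat.add_sub_cancel' hij] at h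
  exact h.symm

theorem exists_equidistant (hG : G.Connected) {u v : V} {k w : ℕ} (h : k * w ≤ G.dist u v) :
    ∃ c : ℕ → V, ∀ m m', m ≤ m' → m' ≤ k → G.dist (c m) (c m') = (m' - m) * w := by
  obtain ⟨p, hp⟩ := hG.exists_walk_length_eq_dist u v
  refine ⟨fun m => p.getVert (m * w), fun m m' hm hm' => ?_⟩
  rw [dist_getVert hp (Nat.mul_le_mul_right w hm)
    ((Nat.mul_le_mul_right w hm').trans (h.trans hp.ge)), Nat.sub_mul]

end Geodesics

section Expand

variable {V : Type*} [Fintype V]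

open Classical in
/-- One round of breadth first search: `S` together with its neighbours outside of the forbidden
set `B`. -/
noncomputable def expand (G : SimpleGraph V) (B S : Finset V) : Finset V :=
  {v | v ∈ S ∨ v ∉ B ∧ ∃ u ∈ S, G.Adj u v}

variable {G : SimpleGraph V} {B S : Finset V}

theorem mem_expand {v : V} : v ∈ expand G B S ↔ v ∈ S ∨ v ∉ B ∧ ∃ u ∈ S, G.Adj u v := by
  simp [expand]

theorem subset_expand : S ⊆ expand G B S := fun _ hv => mem_expand.2 (Or.inl hv)

theorem monotone_iterate_expand : Monotone fun k => (expand G B)^[k] S :=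
  monotone_nat_of_le_succ fun k => by
    simpa only [Function.iterate_succ_apply'] using subset_expand

theorem mem_iterate_expand_of_walk {u v : V} (p : G.Walk u v) (hu : u ∈ S) :
    v ∈ (expand G ∅)^[p.length] S := by
  induction p generalizing S with
  | nil => exact hu
  | cons huw _ ih => exact ih (mem_expand.2 (Or.inr ⟨notMem_empty _, _, hu, huw⟩))

theorem exists_dist_le_of_mem_iterate_expand (hG : G.Connected) {k : ℕ} {v : V}
    (hv : v ∈ (expand G B)^[k] S) : ∃ u ∈ S, G.dist u v ≤ k := by
  induction k generalizing v with
  | zero => exact ⟨v, hv, by simp⟩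
  | succ k ih =>
    rw [Function.iterate_succ_apply', mem_expand] at hv
    rcases hv with hv | ⟨-, w, hw, hwv⟩
    · obtain ⟨u, hu, huv⟩ := ih hv
      exact ⟨u, hu, huv.trans k.le_succ⟩
    · obtain ⟨u, hu, huw⟩ := ih hw
      refine ⟨u, hu, (hG.dist_triangle (v := w)).trans ?_⟩
      exact add_le_add huw (SimpleGraph.dist_eq_one_iff_adj.2 hwv).le

theorem mem_iterate_expand_empty_iff (hG : G.Connected) {k : ℕ} {v : V} :
    v ∈ (expand G ∅)^[k] S ↔ ∃ u ∈ S, G.dist u v ≤ k := by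
  refine ⟨exists_dist_le_of_mem_iterate_expand hG, fun ⟨u, hu, huv⟩ => ?_⟩
  obtain ⟨p, hp⟩ := hG.exists_walk_length_eq_dist u v
  exact monotone_iterate_expand (hp.trans_le huv) (mem_iterate_expand_of_walk p hu)

theorem exists_seq_of_mem_iterate_expand {p v : V} {s : ℕ} (hp : p ∉ B)
    (hv : v ∈ (expand G B)^[s] {p}) :
    ∃ f : ℕ → V, f 0 = p ∧ (∀ i, s ≤ i → f i = v) ∧ (∀ i, G.dist (f i) (f (i + 1)) ≤ 1) ∧
      ∀ i, f i ∉ B := by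
  induction s generalizing v with
  | zero =>
    obtain rfl : v = p := by simpa using hv
    exact ⟨fun _ => v, rfl, fun _ _ => rfl, by simp, fun _ => hp⟩
  | succ s ih =>
    obtain ⟨u, hu, huv, hvB⟩ :
        ∃ u ∈ (expand G B)^[s] {p}, G.dist u v ≤ 1 ∧ (u = v ∨ v ∉ B) := by
      rw [Function.iterate_succ_apply', mem_expand] at hv
      rcases hv with hv | ⟨hB, w, hw, hwv⟩
      · exact ⟨v, hv, by simp, Or.inl rfl⟩
      · exact ⟨w, hw, (SimpleGraph.dist_eq_one_iff_adj.2 hwv).le, Or.inr hB⟩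
    obtain ⟨f, hf₀, hfs, hf, hfB⟩ := ih hu
    have hvB : v ∉ B := hvB.elim (fun h => h ▸ hfs s le_rfl ▸ hfB s) id
    refine ⟨fun i => if i ≤ s then f i else v, by simpa using hf₀,
      fun i hi => if_neg (by omega), fun i => ?_, fun i => ?_⟩
    · rcases lt_trichotomy i s with hi | rfl | hi
      · simpa [hi.le, Nat.succ_le_of_lt hi] using hf i
      · simpa [hfs i le_rfl] using huv
      · simp [hi.not_ge, (hi.trans i.lt_succ_self).not_ge]
    · dsimp only
      split_ifs
      exacts [hfB i, hvB]

theorem card_expand_le [DecidableRel G.Adj] {d : ℕ} (hd : ∀ v, G.degree v ≤ d) :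
    #(expand G B S) ≤ (d + 1) * #S := by
  classical
  have hsub : expand G B S ⊆ S ∪ S.biUnion fun u => G.neighborFinset u := by
    intro v hv
    rcases mem_expand.1 hv with hv | ⟨-, u, hu, huv⟩
    · exact mem_union_left _ hv
    · exact mem_union_right _ (mem_biUnion.2 ⟨u, hu, by simpa using huv⟩)
  have hneighbors : #(S.biUnion fun u => G.neighborFinset u) ≤ #S * d :=
    card_biUnion_le_card_mul _ _ _ fun u _ => by simpa using hd u
  calc #(expand G B S) ≤ #S + #(S.biUnion fun u => G.neighborFinset u) :=
        (card_le_card hsub).trans (card_union_le _ _)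
    _ ≤ #S + #S * d := Nat.add_le_add_left hneighbors _
    _ = (d + 1) * #S := by ring

theorem card_iterate_expand_le [DecidableRel G.Adj] {d : ℕ} (hd : ∀ v, G.degree v ≤ d) (r : ℕ) :
    #((expand G B)^[r] S) ≤ (d + 1) ^ r * #S := by
  induction r with
  | zero => simp
  | succ r ih =>
    rw [Function.iterate_succ_apply', pow_succ', mul_assoc]
    exact (card_expand_le hd).trans (Nat.mul_le_mul_left _ ih)

theorem exists_lt_dist [DecidableRel G.Adj] (hG : G.Connected) {d R : ℕ}
    (hd : ∀ v, G.degree v ≤ d) (hR : (d + 1) ^ R < Fintype.card V) :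
    ∃ u v, R < G.dist u v := by
  by_contra! hdist
  obtain ⟨u⟩ := hG.nonempty
  have huniv : univ ⊆ (expand G ∅)^[R] {u} := fun v _ =>
    (mem_iterate_expand_empty_iff hG).2 ⟨u, mem_singleton_self u, hdist u v⟩
  have hcard := (card_le_card huniv).trans (card_iterate_expand_le hd R)
  rw [card_univ, card_singleton, mul_one] at hcard
  omega

theorem dist_lt_card (hG : G.Connected) (u v : V) : G.dist u v < Fintype.card V := by
  obtain ⟨p, hp, hp_len⟩ := hG.exists_path_of_dist u v
  exact hp_len ▸ hp.length_lt

end Expand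

section ConfinedSearch

variable {V : Type*} [Fintype V] {G : SimpleGraph V} {δ : ℝ}

theorem lt_dist_of_mem_iterate_expand (hG : G.Connected) (hδ : IsHyperbolic G δ)
    {B : Finset V} {p x y z : V} {c : ℝ} {s N r : ℕ} (hr : δ * N + c ≤ r)
    (hB : ∀ v, G.dist x v ≤ r → v ∈ B) (hp : p ∉ B) (hs : s ≤ 2 ^ N)
    (hz : z ∈ (expand G B)^[s] {p}) (hy : OnGeodesic G p y z) : c < G.dist x y := by
  by_contra! hxy
  obtain ⟨f, hf₀, hfs, hf, hfB⟩ := exists_seq_of_mem_iterate_expand hp hz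
  obtain ⟨i, hyi⟩ := exists_near_seq hG hδ N hf (by rwa [hf₀, hfs _ hs])
  refine hfB i (hB _ ?_)
  have hxi : (G.dist x (f i) : ℝ) ≤ r := by linarith [cast_dist_le_add hG x y (f i)]
  exact_mod_cast hxi

variable [DecidableEq V]

/-- The set of nodes that `k` rounds of breadth first search from `p` reach without entering the
balls of radius `r` around `x` and `y`. -/
noncomputable def confinedSearch (G : SimpleGraph V) (x y p : V) (r k : ℕ) : Finset V :=
  (expand G ((expand G ∅)^[r] {x, y}))^[k] {p}

theorem disjoint_confinedSearch (hG : G.Connected) (hδ : IsHyperbolic G δ)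
    {x b p a y q : V} {N r s : ℕ} (hr : δ * (N + 3) ≤ r) (hs : s ≤ 2 ^ N)
    (hxp : r < G.dist x p) (hbp : r < G.dist b p) (haq : r < G.dist a q) (hyq : r < G.dist y q)
    (h : G.dist p b + G.dist b a + G.dist a q = G.dist p q) :
    Disjoint (confinedSearch G x b p r s) (confinedSearch G a y q r s) := by
  have hr' : δ * N + 3 * δ ≤ r := by linarith
  rw [disjoint_left]
  intro z hzp hzq
  rcases exists_near_or_exists_near hG hδ h z with ⟨v, hv, hbv⟩ | ⟨v, hv, hav⟩
  · refine hbv.not_gt (lt_dist_of_mem_iterate_expand hG hδ hr' ?_ ?_ hs hzp hv)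
    · exact fun w hw => (mem_iterate_expand_empty_iff hG).2 ⟨b, by simp, hw⟩
    · simp [mem_iterate_expand_empty_iff hG, hxp, hbp]
  · refine hav.not_gt (lt_dist_of_mem_iterate_expand hG hδ hr' ?_ ?_ hs hzq hv)
    · exact fun w hw => (mem_iterate_expand_empty_iff hG).2 ⟨a, by simp, hw⟩
    · simp [mem_iterate_expand_empty_iff hG, haq, hyq]

theorem not_adj_of_mem_confinedSearch (hG : G.Connected) {x y p u v : V} {r s t : ℕ}
    (hx : t + r < G.dist x p) (hy : t + r < G.dist y p) (hs : s < t)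
    (hu : u ∈ confinedSearch G x y p r s) (hv : v ∈ (expand G ∅)^[r] {x, y}) : ¬G.Adj u v := by
  intro huv
  obtain ⟨w, hw, hpu⟩ := exists_dist_le_of_mem_iterate_expand hG hu
  rw [mem_singleton.1 hw, G.dist_comm] at hpu
  obtain ⟨z, hz, hzv⟩ := (mem_iterate_expand_empty_iff hG).1 hv
  have huv' := SimpleGraph.dist_eq_one_iff_adj.2 huv.symm
  have hzp : t + r < G.dist z p := by
    rcases mem_insert.1 hz with rfl | hz
    · exact hx
    · rwa [mem_singleton.1 hz]
  have hzu := hG.dist_triangle (u := z) (v := v) (w := u)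
  have hzp' := hG.dist_triangle (u := z) (v := u) (w := p)
  omega

end ConfinedSearch

section Counting

variable {V : Type*} [Fintype V] {G : SimpleGraph V} [DecidableRel G.Adj] {d : ℕ}

theorem vol_eq_mul_card (hd : G.IsRegularOfDegree d) (U : Finset V) : vol G U = d * #U := by
  simp [vol, hd.degree_eq, mul_comm]

variable [DecidableEq V]

theorem cutSize_le_mul_card (hd : G.IsRegularOfDegree d) {U W : Finset V}
    (hW : ∀ u ∈ U, ∀ v, v ∉ U → G.Adj u v → v ∈ W) : cutSize G U ≤ d * #W := by
  have hsub : G.interedges U Uᶜ ⊆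
      W.biUnion fun w => (G.neighborFinset w).image fun u => (u, w) := by
    rintro ⟨u, v⟩ huv
    obtain ⟨hu, hv, hadj⟩ := G.mk_mem_interedges_iff.1 huv
    simp only [mem_biUnion, mem_image, SimpleGraph.mem_neighborFinset]
    exact ⟨v, hW u hu v (mem_compl.1 hv) hadj, u, hadj.symm, rfl⟩
  rw [mul_comm]
  refine (card_le_card hsub).trans (card_biUnion_le_card_mul _ _ d fun w _ => ?_)
  exact card_image_le.trans (by simp [hd.degree_eq])

theorem card_lt_mul_card (hd : G.IsRegularOfDegree d) {M : ℕ} {U W : Finset V}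
    (hU : vol G U < M * cutSize G U) (hW : ∀ u ∈ U, ∀ v, v ∉ U → G.Adj u v → v ∈ W) :
    #U < M * #W := by
  rw [vol_eq_mul_card hd] at hU
  refine Nat.lt_of_mul_lt_mul_left (a := d) (hU.trans_le ?_)
  calc M * cutSize G U ≤ M * (d * #W) := Nat.mul_le_mul_left M (cutSize_le_mul_card hd hW)
    _ = d * (M * #W) := Nat.mul_left_comm M d _

theorem card_expand_ge (hd : G.IsRegularOfDegree d) {M : ℕ} {B U : Finset V}
    (hU : vol G U < M * cutSize G U)
    (hB : (∀ u ∈ U, ∀ v ∈ B, ¬G.Adj u v) ∨ 2 * M * #B ≤ #U) :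
    (2 * M + 1) * #U ≤ 2 * M * #(expand G B U) := by
  have hmem : ∀ u ∈ U, ∀ v, v ∉ U → v ∉ B → G.Adj u v → v ∈ expand G B U \ U :=
    fun u hu v hvU hvB huv => mem_sdiff.2 ⟨mem_expand.2 (Or.inr ⟨hvB, u, hu, huv⟩), hvU⟩
  rw [← card_sdiff_add_card_eq_card (subset_expand (G := G) (B := B) (S := U))]
  rcases hB with hB | hB
  · have hcard := card_lt_mul_card hd hU (W := expand G B U \ U) fun u hu v hvU huv =>
      hmem u hu v hvU (fun hvB => hB u hu v hvB huv) huv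
    linarith
  · have hcard := card_lt_mul_card hd hU (W := expand G B U \ U ∪ B) fun u hu v hvU huv => by
      by_cases hvB : v ∈ B
      · exact mem_union_right _ hvB
      · exact mem_union_left _ (hmem u hu v hvU hvB huv)
    have hunion := Nat.mul_le_mul_left M (card_union_le (expand G B U \ U) B)
    linarith

end Counting

section Growth

theorem two_mul_pow_self_le {c : ℕ} (hc : c ≠ 0) : 2 * c ^ c ≤ (c + 1) ^ c := by
  have h := pow_add_mul_le_add_pow (Nat.zero_le c) (Nat.zero_le (2 * c + 1)) c
  rwa [mul_one, Nat.cast_id, mul_pow_sub_one hc, ← two_mul] at h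

theorem pow_mul_le_of_growth {c T : ℕ} {a : ℕ → ℕ}
    (h : ∀ s < T, (c + 1) * a s ≤ c * a (s + 1)) {j : ℕ} (hj : j ≤ T) :
    (c + 1) ^ j * a 0 ≤ c ^ j * a j := by
  induction j with
  | zero => simp
  | succ j ih =>
    calc (c + 1) ^ (j + 1) * a 0 = (c + 1) * ((c + 1) ^ j * a 0) := by ring
      _ ≤ (c + 1) * (c ^ j * a j) := Nat.mul_le_mul_left _ (ih (by omega))
      _ = c ^ j * ((c + 1) * a j) := by ring
      _ ≤ c ^ j * (c * a (j + 1)) := Nat.mul_le_mul_left _ (h j hj)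
      _ = c ^ (j + 1) * a (j + 1) := by ring

theorem two_pow_mul_le_of_growth {c t : ℕ} {a : ℕ → ℕ} (hc : c ≠ 0)
    (h : ∀ s < c * t, (c + 1) * a s ≤ c * a (s + 1)) : 2 ^ t * a 0 ≤ a (c * t) := by
  refine Nat.le_of_mul_le_mul_left (c := c ^ (c * t)) ?_ (by positivity)
  calc c ^ (c * t) * (2 ^ t * a 0) = (2 * c ^ c) ^ t * a 0 := by rw [mul_pow, pow_mul]; ring
    _ ≤ ((c + 1) ^ c) ^ t * a 0 :=
      Nat.mul_le_mul_right _ (Nat.pow_le_pow_left (two_mul_pow_self_le hc) t)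
    _ ≤ c ^ (c * t) * a (c * t) := by
      rw [← pow_mul]
      exact pow_mul_le_of_growth h le_rfl

theorem exists_mul_card_le_of_pairwiseDisjoint {V : Type*} [Fintype V] {K : ℕ} (hK : K ≠ 0)
    {U : ℕ → Finset V} (hU : ((range K : Finset ℕ) : Set ℕ).PairwiseDisjoint U) :
    ∃ i < K, K * #(U i) ≤ Fintype.card V := by
  classical
  have hsum : ∑ i ∈ range K, K * #(U i) ≤ ∑ _i ∈ range K, Fintype.card V := by
    rw [← mul_sum, ← card_biUnion hU, sum_const, card_range, smul_eq_mul]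
    exact Nat.mul_le_mul_left K (card_le_univ _)
  simpa using exists_le_of_sum_le (nonempty_range_iff.2 hK) hsum

end Growth

section SparseSets

variable {V : Type*} [Fintype V] [DecidableEq V] {G : SimpleGraph V} [DecidableRel G.Adj] {d : ℕ}

/-- `S` is a non-empty set of at most `|V| / K` nodes with normalized expansion at most `1 / M`. -/
def IsSparse (G : SimpleGraph V) [DecidableRel G.Adj] (K M : ℕ) (S : Finset V) : Prop :=
  S.Nonempty ∧ K * #S ≤ Fintype.card V ∧ M * cutSize G S ≤ vol G S

theorem IsSparse.isSmallNonexpanding {K M : ℕ} {ζ ε : ℝ} {S : Finset V} (h : IsSparse G K M S)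
    (hK : 1 ≤ ζ * K) (hM : 1 ≤ ε * M) (hζ : 0 < ζ) (hε : 0 < ε) : IsSmallNonexpanding G ζ ε S := by
  obtain ⟨hne, hcard, hcut⟩ := h
  have hcard' : (K : ℝ) * #S ≤ Fintype.card V := mod_cast hcard
  have hcut' : (M : ℝ) * cutSize G S ≤ vol G S := mod_cast hcut
  refine ⟨hne, ?_, div_le_of_le_mul₀ (Nat.cast_nonneg _) hε.le ?_⟩
  · calc (#S : ℝ) ≤ ζ * K * #S := le_mul_of_one_le_left (Nat.cast_nonneg _) hK
      _ = ζ * (K * #S) := mul_assoc _ _ _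
      _ ≤ ζ * Fintype.card V := by gcongr
  · calc (cutSize G S : ℝ) ≤ ε * M * cutSize G S := le_mul_of_one_le_left (Nat.cast_nonneg _) hM
      _ = ε * (M * cutSize G S) := mul_assoc _ _ _
      _ ≤ ε * vol G S := by gcongr

/-- The search grows geometrically: while it has not reached `B`, because nothing obstructs it, and
afterwards because it has outgrown `B`. -/
theorem exists_mul_cutSize_le_vol (hd : G.IsRegularOfDegree d) {M t₀ t₁ : ℕ} {B : Finset V} {p : V}
    (hM : M ≠ 0) (hB : 2 * M * #B ≤ 2 ^ t₀) (hcard : Fintype.card V < 2 ^ t₁)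
    (hfar : ∀ s < 2 * M * t₀, ∀ u ∈ (expand G B)^[s] {p}, ∀ v ∈ B, ¬G.Adj u v) :
    ∃ s < 2 * M * t₁,
      M * cutSize G ((expand G B)^[s] {p}) ≤ vol G ((expand G B)^[s] {p}) := by
  by_contra! hcut
  set a : ℕ → ℕ := fun s => #((expand G B)^[s] {p})
  have ha₀ : a 0 = 1 := card_singleton p
  have hstep : ∀ s < 2 * M * t₁,
      ((∀ u ∈ (expand G B)^[s] {p}, ∀ v ∈ B, ¬G.Adj u v) ∨ 2 * M * #B ≤ a s) →
        (2 * M + 1) * a s ≤ 2 * M * a (s + 1) := fun s hs hs' => by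
    simpa only [a, Function.iterate_succ_apply'] using card_expand_ge hd (hcut s hs) hs'
  have hgrowth : ∀ s < 2 * M * t₁, (2 * M + 1) * a s ≤ 2 * M * a (s + 1) := fun s hs => by
    refine hstep s hs ((lt_or_ge s (2 * M * t₀)).imp (hfar s) fun hs₀ => ?_)
    calc 2 * M * #B ≤ 2 ^ t₀ * a 0 := by rwa [ha₀, mul_one]
      _ ≤ a (2 * M * t₀) := two_pow_mul_le_of_growth (by omega) fun s' hs' =>
          hstep s' (by omega) (Or.inl (hfar s' hs'))
      _ ≤ a s := card_le_card (monotone_iterate_expand hs₀)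
  have hlarge := two_pow_mul_le_of_growth (by omega) hgrowth
  rw [ha₀, mul_one] at hlarge
  exact hcard.not_ge (hlarge.trans (card_le_univ _))

theorem exists_isSparse_confinedSearch_of_card_le (hG : G.Connected) (hd : G.IsRegularOfDegree d)
    {K M r t₀ t₁ : ℕ} {x y p : V} (hM : M ≠ 0) (ht₀ : 4 * M * (d + 1) ^ r ≤ 2 ^ t₀)
    (ht₁ : Fintype.card V < 2 ^ t₁) (hx : 2 * M * t₀ + r < G.dist x p)
    (hy : 2 * M * t₀ + r < G.dist y p)
    (hcard : K * #(confinedSearch G x y p r (2 * M * t₁)) ≤ Fintype.card V) :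
    ∃ s < 2 * M * t₁, IsSparse G K M (confinedSearch G x y p r s) := by
  have hball : 2 * M * #((expand G ∅)^[r] {x, y}) ≤ 2 ^ t₀ :=
    calc 2 * M * #((expand G ∅)^[r] {x, y}) ≤ 2 * M * ((d + 1) ^ r * 2) := by
          refine Nat.mul_le_mul_left _ ?_
          exact (card_iterate_expand_le (fun v => (hd.degree_eq v).le) r).trans
            (Nat.mul_le_mul_left _ card_le_two)
      _ = 4 * M * (d + 1) ^ r := by ring
      _ ≤ 2 ^ t₀ := ht₀
  obtain ⟨s, hs, hcut⟩ := exists_mul_cutSize_le_vol hd (p := p) hM hball ht₁ fun s hs u hu v hv =>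
    not_adj_of_mem_confinedSearch hG hx hy hs hu hv
  have hp : p ∈ confinedSearch G x y p r s :=
    monotone_iterate_expand (Nat.zero_le s) (mem_singleton_self p)
  refine ⟨s, hs, ⟨p, hp⟩, (Nat.mul_le_mul_left K (card_le_card ?_)).trans hcard, hcut⟩
  exact monotone_iterate_expand hs.le

theorem exists_isSparse_confinedSearch {δ : ℝ} (hG : G.Connected) (hd : G.IsRegularOfDegree d)
    (hδ : IsHyperbolic G δ) {K M N r t₀ t₁ w : ℕ} (hK : K ≠ 0) (hM : M ≠ 0)
    (hr : δ * (N + 3) ≤ r) (ht₀ : 4 * M * (d + 1) ^ r ≤ 2 ^ t₀) (ht₁ : Fintype.card V < 2 ^ t₁)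
    (hT : 2 * M * t₁ ≤ 2 ^ N) (hTn : 2 * M * t₁ ≤ Fintype.card V) (hw : 2 * M * t₀ + r < w)
    (hdiam : (d + 1) ^ (2 * K * w) < Fintype.card V) :
    ∃ x y p, ∃ r < Fintype.card V, ∃ s < Fintype.card V,
      IsSparse G K M (confinedSearch G x y p r s) := by
  obtain ⟨u, v, huv⟩ := exists_lt_dist hG (fun v => (hd.degree_eq v).le) hdiam
  obtain ⟨c, hc⟩ := exists_equidistant hG huv.le
  have hwall : ∀ m < 2 * K, G.dist (c m) (c (m + 1)) = w := fun m hm => by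
    rw [hc m (m + 1) m.le_succ hm, Nat.add_sub_cancel_left, one_mul]
  have hwall' : ∀ m < 2 * K, G.dist (c (m + 1)) (c m) = w := fun m hm => by
    rw [G.dist_comm, hwall m hm]
  set U : ℕ → Finset V := fun i =>
    confinedSearch G (c (2 * i)) (c (2 * i + 2)) (c (2 * i + 1)) r (2 * M * t₁)
  have hdisj : ∀ i j, i < j → j < K → Disjoint (U i) (U j) := fun i j hij hj => by
    refine disjoint_confinedSearch hG hδ hr hT ?_ ?_ ?_ ?_ ?_
    · rw [hwall _ (by omega)]; omega
    · rw [hwall' _ (by omega)]; omega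
    · rw [hwall _ (by omega)]; omega
    · rw [hwall' _ (by omega)]; omega
    · simp only [hc _ _ (show 2 * i + 1 ≤ 2 * i + 2 by omega) (by omega),
        hc _ _ (show 2 * i + 2 ≤ 2 * j by omega) (by omega),
        hc _ _ (show 2 * j ≤ 2 * j + 1 by omega) (by omega),
        hc _ _ (show 2 * i + 1 ≤ 2 * j + 1 by omega) (by omega), ← add_mul]
      congr 1
      omega
  obtain ⟨i, hi, hcard⟩ := exists_mul_card_le_of_pairwiseDisjoint hK (U := U) fun i hi j hj hij =>
    hij.lt_or_gt.elim (fun h => hdisj i j h (by simpa using hj))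
      fun h => (hdisj j i h (by simpa using hi)).symm
  obtain ⟨s, hs, hsparse⟩ := exists_isSparse_confinedSearch_of_card_le hG hd hM ht₀ ht₁
    (hw.trans_eq (hwall _ (by omega)).symm) (hw.trans_eq (hwall' _ (by omega)).symm) hcard
  refine ⟨_, _, _, r, ?_, s, hs.trans_le hTn, hsparse⟩
  calc r < w := by omega
    _ = G.dist (c (2 * i)) (c (2 * i + 1)) := (hwall _ (by omega)).symm
    _ < Fintype.card V := dist_lt_card hG _ _

end SparseSets

section Parameters

open Filter

theorem eventually_mul_rpow_lt {a : ℝ} (ha : a < 1) (c : ℝ) : ∀ᶠ x : ℝ in atTop, c * x ^ a < x := by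
  filter_upwards [(tendsto_rpow_atTop (sub_pos.2 ha)).eventually_gt_atTop c,
    eventually_gt_atTop 0] with x hc hx
  calc c * x ^ a < x ^ (1 - a) * x ^ a := by gcongr
    _ = x := by rw [← Real.rpow_add hx, sub_add_cancel, Real.rpow_one]

theorem eventually_mul_add_one_le_two_rpow {σ : ℝ} (hσ : 0 < σ) (c : ℝ) :
    ∀ᶠ x : ℝ in atTop, c * (x + 1) ≤ 2 ^ x ^ σ := by
  have hexp : ∀ᶠ y : ℝ in atTop, 2 * |c| * y ^ σ⁻¹ ≤ 2 ^ y := by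
    filter_upwards [(isLittleO_rpow_exp_pos_mul_atTop σ⁻¹ (Real.log_pos one_lt_two)).bound
      (show 0 < (2 * |c| + 1)⁻¹ by positivity), eventually_ge_atTop 0] with y hy hy₀
    rw [Real.norm_of_nonneg (by positivity), Real.norm_of_nonneg (by positivity),
      ← Real.rpow_def_of_pos two_pos, le_inv_mul_iff₀ (by positivity)] at hy
    linarith [Real.rpow_nonneg hy₀ σ⁻¹]
  filter_upwards [(tendsto_rpow_atTop hσ).eventually hexp, eventually_ge_atTop 1] with x hx hx₁
  rw [Real.rpow_rpow_inv (by positivity) hσ.ne'] at hx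
  calc c * (x + 1) ≤ |c| * (x + x) := by gcongr; exact le_abs_self c
    _ = 2 * |c| * x := by ring
    _ ≤ 2 ^ x ^ σ := hx

theorem exists_add_one_le_two_pow {d : ℕ} {x : ℝ} (hx : 1 ≤ x) (hd : (d : ℝ) ≤ 2 ^ x) :
    ∃ b : ℕ, b ≠ 0 ∧ d + 1 ≤ 2 ^ b ∧ (b : ℝ) ≤ 3 * x := by
  refine ⟨⌈x⌉₊ + 1, Nat.succ_ne_zero _, ?_, ?_⟩
  · have hceil : (d : ℝ) ≤ 2 ^ ⌈x⌉₊ := by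
      rw [← Real.rpow_natCast]
      exact hd.trans (Real.rpow_le_rpow_of_exponent_le one_le_two (Nat.le_ceil x))
    have hceil' : d ≤ 2 ^ ⌈x⌉₊ := mod_cast hceil
    rw [pow_succ, mul_two]
    exact add_le_add hceil' Nat.one_le_two_pow
  · push_cast
    linarith [Nat.ceil_le_two_mul (a := x) (by linarith)]

theorem exists_radius {y z : ℝ} (hy : 1 ≤ y) (hz : 1 ≤ z) :
    ∃ N r : ℕ, y ≤ N ∧ z * (N + 3) ≤ r ∧ r ≠ 0 ∧ (r : ℝ) ≤ 10 * (z * y) := by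
  have hN : (⌈y⌉₊ : ℝ) + 3 ≤ 5 * y := by linarith [Nat.ceil_le_two_mul (a := y) (by linarith)]
  have hr : 1 ≤ z * (⌈y⌉₊ + 3) :=
    one_le_mul_of_one_le_of_one_le hz (by linarith [Nat.cast_nonneg (α := ℝ) ⌈y⌉₊])
  refine ⟨⌈y⌉₊, ⌈z * (⌈y⌉₊ + 3)⌉₊, Nat.le_ceil y, Nat.le_ceil _,
    (Nat.ceil_pos.2 (by linarith)).ne', ?_⟩
  calc (⌈z * (⌈y⌉₊ + 3)⌉₊ : ℝ) ≤ 2 * (z * (⌈y⌉₊ + 3)) := Nat.ceil_le_two_mul (by linarith)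
    _ ≤ 2 * (z * (5 * y)) := by gcongr
    _ = 10 * (z * y) := by ring

theorem gap_lt {M r b : ℕ} (hr : r ≠ 0) (hb : b ≠ 0) :
    2 * M * (r * b + 4 * M) + r < (2 * M * (1 + 4 * M) + 2) * (r * b) := by
  have hrb : 1 ≤ r * b := Nat.one_le_iff_ne_zero.2 (Nat.mul_ne_zero hr hb)
  have hrb' : r ≤ r * b := Nat.le_mul_of_pos_right r (Nat.pos_of_ne_zero hb)
  have hMrb : 8 * M * M * 1 ≤ 8 * M * M * (r * b) := Nat.mul_le_mul_left _ hrb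
  linarith

theorem pow_lt_of_mul_lt_logb {m b k n : ℕ} (hm : m ≤ 2 ^ b) (hn : n ≠ 0)
    (h : (b : ℝ) * k < Real.logb 2 n) : m ^ k < n := by
  rw [Real.lt_logb_iff_rpow_lt one_lt_two (by positivity)] at h
  have h' : 2 ^ (b * k) < n := by exact_mod_cast h
  exact (Nat.pow_le_pow_left hm k).trans_lt (by rwa [← pow_mul])

/-- The diameter of the graph is at least `log n / log (d + 1)`, and the search needs about
`log (d + 1) * r` of it, where `r` is only slightly larger than `(log n) ^ β`. -/
theorem exists_search_parameters {α β : ℝ} (hα : 0 ≤ α) (hβ : 0 ≤ β) (hαβ : 2 * α + β < 1)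
    (K M : ℕ) :
    ∀ᶠ n : ℕ in atTop, ∀ d : ℕ, (d : ℝ) ≤ 2 ^ Real.logb 2 n ^ α →
      ∃ N r t₀ t₁ w : ℕ, Real.logb 2 n ^ β * (N + 3) ≤ r ∧ 4 * M * (d + 1) ^ r ≤ 2 ^ t₀ ∧
        n < 2 ^ t₁ ∧ 2 * M * t₁ ≤ 2 ^ N ∧ 2 * M * t₁ ≤ n ∧ 2 * M * t₀ + r < w ∧
        (d + 1) ^ (2 * K * w) < n := by
  obtain ⟨σ, hσ, hσαβ⟩ : ∃ σ, 0 < σ ∧ 2 * σ = 1 - (2 * α + β) :=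
    ⟨(1 - (2 * α + β)) / 2, by linarith, by ring⟩
  set C := 2 * M * (1 + 4 * M) + 2
  have hlog : Tendsto (fun n : ℕ => Real.logb 2 n) atTop atTop :=
    (Real.tendsto_logb_atTop one_lt_two).comp tendsto_natCast_atTop_atTop
  filter_upwards [hlog.eventually (eventually_mul_add_one_le_two_rpow hσ (2 * M)),
    hlog.eventually (eventually_mul_rpow_lt (a := 1 - σ) (by linarith) (180 * K * C)),
    hlog.eventually_ge_atTop 1, eventually_ne_atTop 0] with n hexp hlt hL hn d hd
  set L := Real.logb 2 n
  have hL₀ : 0 < L := by linarith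
  obtain ⟨b, hb₀, hdb, hb⟩ := exists_add_one_le_two_pow (Real.one_le_rpow hL hα) hd
  obtain ⟨N, r, hN, hr, hr₀, hr'⟩ :=
    exists_radius (Real.one_le_rpow hL hσ.le) (Real.one_le_rpow hL hβ)
  have ht₁ : ((2 * M * (Nat.log 2 n + 1) : ℕ) : ℝ) ≤ 2 ^ L ^ σ := by
    refine le_trans ?_ hexp
    push_cast
    gcongr
    exact Real.natLog_le_logb n 2
  refine ⟨N, r, r * b + 4 * M, Nat.log 2 n + 1, C * (r * b), hr, ?_,
    Nat.lt_pow_succ_log_self one_lt_two n, ?_, ?_, ?_, pow_lt_of_mul_lt_logb hdb hn ?_⟩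
  · calc 4 * M * (d + 1) ^ r ≤ 2 ^ (4 * M) * (2 ^ b) ^ r :=
          Nat.mul_le_mul Nat.lt_two_pow_self.le (Nat.pow_le_pow_left hdb r)
      _ = 2 ^ (r * b + 4 * M) := by rw [← pow_mul, ← pow_add]; congr 1; ring
  · have hN' : (2 : ℝ) ^ L ^ σ ≤ 2 ^ N := by
      rw [← Real.rpow_natCast]
      exact Real.rpow_le_rpow_of_exponent_le one_le_two hN
    exact_mod_cast ht₁.trans hN'
  · have hn' : (2 : ℝ) ^ L ^ σ ≤ n := by
      calc (2 : ℝ) ^ L ^ σ ≤ 2 ^ L := Real.rpow_le_rpow_of_exponent_le one_le_two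
            (Real.rpow_le_self_of_one_le hL (by linarith))
        _ = n := Real.rpow_logb two_pos one_lt_two.ne' (by positivity)
    exact_mod_cast ht₁.trans hn'
  · exact gap_lt hr₀ hb₀
  · have hexponent : L ^ β * L ^ σ * (L ^ α * L ^ α) = L ^ (1 - σ) := by
      rw [← Real.rpow_add hL₀, ← Real.rpow_add hL₀, ← Real.rpow_add hL₀]
      congr 1
      linarith
    calc (b : ℝ) * (2 * K * (C * (r * b)) : ℕ) = 2 * K * C * (r * (b * b)) := by push_cast; ring
      _ ≤ 2 * K * C * (10 * (L ^ β * L ^ σ) * (3 * L ^ α * (3 * L ^ α))) := by gcongr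
      _ = 180 * K * C * L ^ (1 - σ) := by rw [← hexponent]; ring
      _ < L := hlt

end Parameters

end HyperbolicCut

namespace RAM

open Finset

section ForPrograms

open Polynomial

/-- The state `s` with the number `m` written to the register `x`. -/
def State.setReg (s : State) (x m : ℕ) : State :=
  ⟨Function.update s.reg x m, s.arr⟩

/-- The state `s` with the number `m` written to the cell `i` of the array `a`. -/
def State.setArr (s : State) (a i m : ℕ) : State :=
  ⟨s.reg, Function.update s.arr a (Function.update (s.arr a) i m)⟩

@[simp]
theorem State.reg_setReg (s : State) (x m y : ℕ) :
    (s.setReg x m).reg y = if y = x then m else s.reg y :=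
  Function.update_apply ..

@[simp]
theorem State.arr_setReg (s : State) (x m : ℕ) : (s.setReg x m).arr = s.arr :=
  rfl

@[simp]
theorem State.arr_setArr (s : State) (a i m b j : ℕ) :
    (s.setArr a i m).arr b j = if b = a ∧ j = i then m else s.arr b j := by
  by_cases hb : b = a
  · subst hb
    simp [setArr, Function.update_apply]
  · simp [setArr, hb]

/-- Programs whose loops count from `0` up to the content of register `0`. They terminate in every
state, so that their meaning is a function `ForProgram.run` on states, and their running time is
bounded by a polynomial `ForProgram.time`. -/
inductive ForProgram where
  | skip
  | assign (x : ℕ) (e : Expr)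
  | store (a : ℕ) (i e : Expr)
  | seq (p q : ForProgram)
  | ite (e : Expr) (p q : ForProgram)
  | forLoop (c : ℕ) (p : ForProgram)

/-- The condition `e` holds in the state `s`. -/
def Expr.IsTrue (e : Expr) (s : State) : Prop :=
  e.eval s ≠ 0

instance (e : Expr) (s : State) : Decidable (e.IsTrue s) :=
  inferInstanceAs (Decidable (e.eval s ≠ 0))

/-- The state of a loop over the register `c` with the body `f`, started in `s`, after `k`
rounds. -/
def countUp (c : ℕ) (f : State → State) (s : State) : ℕ → State
  | 0 => s.setReg c 0
  | k + 1 => (f (countUp c f s k)).setReg c (k + 1)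

namespace ForProgram

/-- The translation into the language of the machine. -/
def toProgram : ForProgram → Program
  | skip => .skip
  | assign x e => .assign x e
  | store a i e => .store a i e
  | seq p q => .seq p.toProgram q.toProgram
  | ite e p q => .ite e p.toProgram q.toProgram
  | forLoop c p => .seq (.assign c (.const 0))
      (.loop (.sub (.reg 0) (.reg c)) (.seq p.toProgram (.assign c (.add (.reg c) (.const 1)))))

/-- The effect of a program. -/
def run : ForProgram → State → State
  | skip, s => s
  | assign x e, s => s.setReg x (e.eval s)
  | store a i e, s => s.setArr a (i.eval s) (e.eval s)
  | seq p q, s => q.run (p.run s)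
  | ite e p q, s => if e.IsTrue s then p.run s else q.run s
  | forLoop c p, s => countUp c p.run s (s.reg 0)

/-- The registers to which a program writes. -/
@[simp]
def regs : ForProgram → Finset ℕ
  | skip => ∅
  | assign x _ => {x}
  | store _ _ _ => ∅
  | seq p q => p.regs ∪ q.regs
  | ite _ p q => p.regs ∪ q.regs
  | forLoop c p => insert c p.regs

/-- The arrays to which a program writes. -/
@[simp]
def arrs : ForProgram → Finset ℕ
  | skip => ∅
  | assign _ _ => ∅
  | store a _ _ => {a}
  | seq p q => p.arrs ∪ q.arrs
  | ite _ p q => p.arrs ∪ q.arrs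
  | forLoop _ p => p.arrs

/-- No loop body writes to the counter of its loop, and nothing is written to register `0`, which
holds the number of rounds. -/
@[simp]
def WellFormed : ForProgram → Prop
  | skip => True
  | assign x _ => x ≠ 0
  | store _ _ _ => True
  | seq p q => p.WellFormed ∧ q.WellFormed
  | ite _ p q => p.WellFormed ∧ q.WellFormed
  | forLoop c p => c ≠ 0 ∧ c ∉ p.regs ∧ p.WellFormed

/-- A bound for the running time, as a polynomial in the content of register `0`. -/
noncomputable def time : ForProgram → ℕ[X]
  | skip => 1
  | assign _ e => (e.cost + 1 : ℕ)
  | store _ i e => (i.cost + e.cost + 1 : ℕ)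
  | seq p q => p.time + q.time
  | ite e p q => (e.cost + 1 : ℕ) + p.time + q.time
  | forLoop _ p => X * (p.time + 8) + 6

end ForProgram

/-- The states `s` and `s'` agree on the registers outside of `X` and the arrays outside of `A`. -/
structure AgreeOff (X A : Finset ℕ) (s s' : State) : Prop where
  reg : ∀ x ∉ X, s'.reg x = s.reg x
  arr : ∀ a ∉ A, s'.arr a = s.arr a

theorem AgreeOff.refl (X A : Finset ℕ) (s : State) : AgreeOff X A s s :=
  ⟨fun _ _ => rfl, fun _ _ => rfl⟩

theorem AgreeOff.trans {X A : Finset ℕ} {s s' s'' : State} (h : AgreeOff X A s s')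
    (h' : AgreeOff X A s' s'') : AgreeOff X A s s'' :=
  ⟨fun x hx => (h'.reg x hx).trans (h.reg x hx), fun a ha => (h'.arr a ha).trans (h.arr a ha)⟩

theorem AgreeOff.mono {X X' A A' : Finset ℕ} {s s' : State} (h : AgreeOff X A s s')
    (hX : X ⊆ X') (hA : A ⊆ A') : AgreeOff X' A' s s' :=
  ⟨fun x hx => h.reg x (mt (@hX x) hx), fun a ha => h.arr a (mt (@hA a) ha)⟩

theorem agreeOff_setReg {X A : Finset ℕ} {x : ℕ} (hx : x ∈ X) (s : State) (m : ℕ) :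
    AgreeOff X A s (s.setReg x m) :=
  ⟨fun _ hy => Function.update_of_ne (ne_of_mem_of_not_mem hx hy).symm _ _, fun _ _ => rfl⟩

theorem agreeOff_countUp {X A : Finset ℕ} {c : ℕ} {f : State → State} (hc : c ∈ X)
    (hf : ∀ s, AgreeOff X A s (f s)) (s : State) (k : ℕ) : AgreeOff X A s (countUp c f s k) := by
  induction k with
  | zero => exact agreeOff_setReg hc s 0
  | succ k ih => exact (ih.trans (hf _)).trans (agreeOff_setReg hc _ _)

theorem reg_countUp (c : ℕ) (f : State → State) (s : State) (k : ℕ) :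
    (countUp c f s k).reg c = k := by
  cases k <;> simp [countUp]

namespace ForProgram

variable {p : ForProgram} {s : State}

theorem agreeOff_run (p : ForProgram) (s : State) : AgreeOff p.regs p.arrs s (p.run s) := by
  induction p generalizing s with
  | skip => exact .refl ..
  | assign x e => exact agreeOff_setReg (mem_singleton_self x) _ _
  | store a i e =>
    exact ⟨fun _ _ => rfl, fun b hb => Function.update_of_ne (by simpa using hb) _ _⟩
  | seq p q hp hq =>
    exact ((hp s).mono subset_union_left subset_union_left).trans
      ((hq _).mono subset_union_right subset_union_right)
  | ite e p q hp hq =>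
    simp only [run]
    split
    · exact (hp s).mono subset_union_left subset_union_left
    · exact (hq s).mono subset_union_right subset_union_right
  | forLoop c p hp =>
    exact agreeOff_countUp (mem_insert_self _ _)
      (fun s => (hp s).mono (subset_insert _ _) subset_rfl) s _

theorem reg_run {x : ℕ} (hx : x ∉ p.regs) : (p.run s).reg x = s.reg x :=
  (agreeOff_run p s).reg x hx

theorem WellFormed.zero_notMem_regs (hp : p.WellFormed) : 0 ∉ p.regs := by
  induction p with
  | skip | store => exact notMem_empty 0
  | assign => simpa using hp.symm
  | seq p q ihp ihq | ite e p q ihp ihq => simpa using ⟨ihp hp.1, ihq hp.2⟩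
  | forLoop c p ihp => simpa using ⟨hp.1.symm, ihp hp.2.2⟩

theorem exec_loop {c n t k j : ℕ} (hc : c ≠ 0) (hcp : c ∉ p.regs) (hp : p.WellFormed)
    (hn : s.reg 0 = n)
    (ih : ∀ s', s'.reg 0 = n → ∃ t' ≤ t, Exec p.toProgram s' t' (p.run s')) (hkj : k + j = n) :
    ∃ t' ≤ j * (t + 8) + 4, Exec
      (.loop (.sub (.reg 0) (.reg c)) (.seq p.toProgram (.assign c (.add (.reg c) (.const 1)))))
      (countUp c p.run s k) t' (countUp c p.run s n) := by
  have hreg (k : ℕ) : (countUp c p.run s k).reg 0 = n := by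
    rw [(agreeOff_countUp (mem_insert_self c p.regs)
      (fun s => (agreeOff_run p s).mono (subset_insert _ _) subset_rfl) s k).reg, hn]
    simpa using ⟨hc.symm, hp.zero_notMem_regs⟩
  induction j generalizing k with
  | zero =>
    obtain rfl : k = n := by omega
    exact ⟨4, by omega, .loop_done (by simp [Expr.eval, hreg, reg_countUp])⟩
  | succ j ihj =>
    obtain ⟨t₁, ht₁, hbody⟩ := ih _ (hreg k)
    obtain ⟨t₂, ht₂, hrest⟩ := ihj (k := k + 1) (by omega)
    have hcount : Exec (.assign c (.add (.reg c) (.const 1))) (p.run (countUp c p.run s k)) 4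
        (countUp c p.run s (k + 1)) := by
      have h := Exec.assign c (.add (.reg c) (.const 1)) (p.run (countUp c p.run s k))
      simp only [Expr.eval, reg_run hcp, reg_countUp] at h
      exact h
    refine ⟨_, ?_, .loop_step ?_ (.seq hbody hcount) hrest⟩
    · simp only [Expr.cost, Nat.succ_mul]
      omega
    · simp only [Expr.eval, hreg, reg_countUp]
      omega

theorem exec_run (hp : p.WellFormed) (s : State) :
    ∃ t ≤ p.time.eval (s.reg 0), Exec p.toProgram s t (p.run s) := by
  induction p generalizing s with
  | skip => exact ⟨1, by simp [time], .skip s⟩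
  | assign x e => exact ⟨_, by simp [time], .assign x e s⟩
  | store a i e => exact ⟨_, by simp [time], .store a i e s⟩
  | seq p q ihp ihq =>
    obtain ⟨t, ht, h⟩ := ihp hp.1 s
    obtain ⟨t', ht', h'⟩ := ihq hp.2 (p.run s)
    rw [reg_run hp.1.zero_notMem_regs] at ht'
    exact ⟨t + t', by simpa [time] using add_le_add ht ht', .seq h h'⟩
  | ite e p q ihp ihq =>
    by_cases he : e.eval s = 0
    · obtain ⟨t, ht, h⟩ := ihq hp.2 s
      refine ⟨e.cost + 1 + t, by simp [time]; omega, ?_⟩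
      simpa [run, Expr.IsTrue, he, toProgram] using .ite_false he h
    · obtain ⟨t, ht, h⟩ := ihp hp.1 s
      refine ⟨e.cost + 1 + t, by simp [time]; omega, ?_⟩
      simpa [run, Expr.IsTrue, he, toProgram] using .ite_true he h
  | forLoop c p ihp =>
    obtain ⟨t, ht, h⟩ := exec_loop (s := s) (k := 0) hp.1 hp.2.1 hp.2.2 rfl
      (fun s' hs' => hs' ▸ ihp hp.2.2 s') (zero_add _)
    exact ⟨2 + t, by simp [time]; omega, .seq (.assign c (.const 0) s) h⟩

theorem run_forLoop_induction {c : ℕ} {I : ℕ → State → Prop} (h_zero : I 0 (s.setReg c 0))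
    (h_succ : ∀ k < s.reg 0, ∀ s', AgreeOff (insert c p.regs) p.arrs s s' → s'.reg c = k →
      I k s' → I (k + 1) ((p.run s').setReg c (k + 1))) :
    I (s.reg 0) ((forLoop c p).run s) := by
  suffices ∀ k ≤ s.reg 0, I k (countUp c p.run s k) from this _ le_rfl
  intro k hk
  induction k with
  | zero => exact h_zero
  | succ k ih =>
    exact h_succ k hk _ (agreeOff_countUp (mem_insert_self _ _)
      (fun s => (agreeOff_run p s).mono (subset_insert _ _) subset_rfl) s k)
      (reg_countUp ..) (ih (Nat.le_of_succ_le hk))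

@[simp]
theorem run_skip (s : State) : skip.run s = s :=
  rfl

@[simp]
theorem run_assign (x : ℕ) (e : Expr) (s : State) : (assign x e).run s = s.setReg x (e.eval s) :=
  rfl

@[simp]
theorem run_store (a : ℕ) (i e : Expr) (s : State) :
    (store a i e).run s = s.setArr a (i.eval s) (e.eval s) :=
  rfl

@[simp]
theorem run_seq (p q : ForProgram) (s : State) : (seq p q).run s = q.run (p.run s) :=
  rfl

@[simp]
theorem run_ite (e : Expr) (p q : ForProgram) (s : State) :
    (ite e p q).run s = if e.IsTrue s then p.run s else q.run s :=
  rfl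

end ForProgram

end ForPrograms

section Conditions

namespace Expr

/-- The condition that `e` does not hold. -/
def not (e : Expr) : Expr :=
  .sub (.const 1) e

/-- The condition that `e` and `f` hold. -/
def and (e f : Expr) : Expr :=
  (e.not.add f.not).not

/-- The condition that the value of `e` is at most the value of `f`. -/
def le (e f : Expr) : Expr :=
  (e.sub f).not

/-- The condition that `e` and `f` have the same value. -/
def eq (e f : Expr) : Expr :=
  (e.le f).and (f.le e)

variable {e f i : Expr} {s : State} {a x c : ℕ}

@[simp]
theorem isTrue_const : (const c).IsTrue s ↔ c ≠ 0 :=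
  Iff.rfl

@[simp]
theorem isTrue_reg : (reg x).IsTrue s ↔ s.reg x ≠ 0 :=
  Iff.rfl

@[simp]
theorem isTrue_get : (get a i).IsTrue s ↔ s.arr a (i.eval s) ≠ 0 :=
  Iff.rfl

@[simp]
theorem isTrue_add : (add e f).IsTrue s ↔ e.IsTrue s ∨ f.IsTrue s := by
  simp only [IsTrue, eval]
  omega

@[simp]
theorem isTrue_sub : (sub e f).IsTrue s ↔ f.eval s < e.eval s := by
  simp only [IsTrue, eval]
  omega

@[simp]
theorem isTrue_not : e.not.IsTrue s ↔ ¬e.IsTrue s := by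
  simp only [IsTrue, not, eval]
  omega

@[simp]
theorem isTrue_and : (e.and f).IsTrue s ↔ e.IsTrue s ∧ f.IsTrue s := by
  simp [and]

@[simp]
theorem isTrue_le : (e.le f).IsTrue s ↔ e.eval s ≤ f.eval s := by
  simp [le]

@[simp]
theorem isTrue_eq : (e.eq f).IsTrue s ↔ e.eval s = f.eval s := by
  simp [eq, le_antisymm_iff]

@[simp]
theorem eval_const : (const c).eval s = c :=
  rfl

@[simp]
theorem eval_reg : (reg x).eval s = s.reg x :=
  rfl

@[simp]
theorem eval_add : (add e f).eval s = e.eval s + f.eval s :=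
  rfl

end Expr

end Conditions

section Encodings

variable {n : ℕ} {G : SimpleGraph (Fin n)} {s s' : State} {X A : Finset ℕ} {p : ForProgram}

/-- Register `0` and array `0` of the state `s` hold the number of nodes and the adjacency matrix
of `G`. -/
structure Encodes (G : SimpleGraph (Fin n)) (s : State) : Prop where
  size : s.reg 0 = n
  adj : ∀ i j : Fin n, s.arr 0 (i * n + j) ≠ 0 ↔ G.Adj i j

theorem Encodes.agreeOff (h : Encodes G s) (hs : AgreeOff X A s s') (hX : 0 ∉ X) (hA : 0 ∉ A) :
    Encodes G s' :=
  ⟨(hs.reg 0 hX).trans h.size, fun i j => by rw [hs.arr 0 hA, h.adj]⟩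

theorem Encodes.run (h : Encodes G s) (hp : p.WellFormed) (hA : 0 ∉ p.arrs) :
    Encodes G (p.run s) :=
  h.agreeOff (p.agreeOff_run s) hp.zero_notMem_regs hA

theorem mul_add_injective {i j i' j' : Fin n} (h : (i : ℕ) * n + j = i' * n + j') :
    (i, j) = (i', j') := by
  refine finProdFinEquiv.injective (Fin.ext ?_)
  simpa only [finProdFinEquiv_apply_val, mul_comm n, add_comm] using h

theorem encodes_input (G : SimpleGraph (Fin n)) [DecidableRel G.Adj] : Encodes G (input G) := by
  refine ⟨rfl, fun i j => ?_⟩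
  simp only [input, true_and, ne_eq, ite_eq_right_iff, one_ne_zero, imp_false, not_not]
  refine ⟨?_, fun h => ⟨i, j, h, rfl⟩⟩
  rintro ⟨i', j', hadj, h⟩
  cases mul_add_injective h
  exact hadj

/-- The set of nodes whose indicator function is held by the array `a`. -/
def nodeSet (n a : ℕ) (s : State) : Finset (Fin n) :=
  {i | s.arr a i ≠ 0}

theorem mem_nodeSet {a : ℕ} {i : Fin n} : i ∈ nodeSet n a s ↔ s.arr a i ≠ 0 := by
  simp [nodeSet]

theorem output_eq_nodeSet (n : ℕ) (s : State) : output n s = nodeSet n 1 s :=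
  rfl

theorem AgreeOff.nodeSet_eq (h : AgreeOff X A s s') {a : ℕ} (ha : a ∉ A) :
    nodeSet n a s' = nodeSet n a s := by
  simp only [nodeSet, h.arr a ha]

theorem nodeSet_run {a : ℕ} (ha : a ∉ p.arrs) : nodeSet n a (p.run s) = nodeSet n a s :=
  (p.agreeOff_run s).nodeSet_eq ha

end Encodings

section Loops

open ForProgram

variable {n : ℕ} {s : State} {e : Expr} {p : ForProgram}

/-- Writes to the array `b` the indicator function of the set of those nodes `i` for which `e`
holds when register `4` contains `i`. -/
def fill (b : ℕ) (e : Expr) : ForProgram :=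
  .forLoop 4 (.store b (.reg 4) e)

@[simp]
theorem regs_fill (b : ℕ) (e : Expr) : (fill b e).regs = {4} :=
  rfl

@[simp]
theorem arrs_fill (b : ℕ) (e : Expr) : (fill b e).arrs = {b} :=
  rfl

@[simp]
theorem wellFormed_fill (b : ℕ) (e : Expr) : (fill b e).WellFormed := by
  simp [fill]

theorem nodeSet_run_fill {b : ℕ} {S : Finset (Fin n)} (hn : s.reg 0 = n)
    (he : ∀ (i : Fin n) (s' : State), AgreeOff {4} {b} s s' → s'.reg 4 = i →
      (e.IsTrue s' ↔ i ∈ S)) :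
    nodeSet n b ((fill b e).run s) = S := by
  have hfill : ∀ i : Fin n, (i : ℕ) < s.reg 0 →
      (((fill b e).run s).arr b i ≠ 0 ↔ i ∈ S) := by
    refine run_forLoop_induction
      (I := fun k s' => ∀ i : Fin n, (i : ℕ) < k → (s'.arr b i ≠ 0 ↔ i ∈ S)) (by simp) ?_
    intro k _ s' hs' hk' ih i hi
    rcases Nat.lt_succ_iff_lt_or_eq.1 hi with hik | hik
    · simpa [hk', hik.ne] using ih i hik
    · simpa [hk', hik, Expr.IsTrue] using he i s' hs' (hk'.trans hik.symm)
  ext i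
  rw [mem_nodeSet, hfill i (hn ▸ i.2)]

/-- Runs `p` for all pairs of nodes that satisfy the condition `e`. The nodes of a pair `(i, j)` are
in the registers `1` and `2`, and register `3` holds the position `i * n + j` of the pair in the
adjacency matrix. -/
def forPairs (e : Expr) (p : ForProgram) : ForProgram :=
  .seq (.assign 3 (.const 0)) (.forLoop 1 (.forLoop 2
    (.seq (.ite e p .skip) (.assign 3 (.add (.reg 3) (.const 1))))))

@[simp]
theorem regs_forPairs (e : Expr) (p : ForProgram) : (forPairs e p).regs = p.regs ∪ {1, 2, 3} := by
  ext x
  simp [forPairs]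

@[simp]
theorem arrs_forPairs (e : Expr) (p : ForProgram) : (forPairs e p).arrs = p.arrs := by
  simp [forPairs]

@[simp]
theorem wellFormed_forPairs :
    (forPairs e p).WellFormed ↔ 1 ∉ p.regs ∧ 2 ∉ p.regs ∧ p.WellFormed := by
  simp [forPairs]

/-- The condition `e` decides membership in the set `E` of pairs, in the course of a loop over all
pairs that is started in the state `s` and whose body writes to the registers in `X` and the arrays
in `A`. -/
def DecidesPairs (e : Expr) (X A : Finset ℕ) (s : State) (E : Finset (Fin n × Fin n)) : Prop :=
  ∀ (s' : State) (i j : Fin n), AgreeOff (X ∪ {1, 2, 3}) A s s' →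
    s'.reg 1 = i → s'.reg 2 = j → s'.reg 3 = i * n + j → (e.IsTrue s' ↔ (i, j) ∈ E)

theorem filter_lt_succ (E : Finset (Fin n × Fin n)) (i j : Fin n) :
    {q ∈ E | (q.1 * n + q.2 : ℕ) < i * n + j + 1} =
      if (i, j) ∈ E then insert (i, j) {q ∈ E | (q.1 * n + q.2 : ℕ) < i * n + j}
      else {q ∈ E | (q.1 * n + q.2 : ℕ) < i * n + j} := by
  have hmem (q : Fin n × Fin n) :
      (q.1 * n + q.2 : ℕ) < i * n + j + 1 ↔ q = (i, j) ∨ (q.1 * n + q.2 : ℕ) < i * n + j := by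
    rw [Nat.lt_succ_iff_lt_or_eq, or_comm]
    refine or_congr_left ⟨mul_add_injective, ?_⟩
    rintro rfl
    rfl
  split_ifs with h <;> ext q <;> simp only [mem_filter, mem_insert, hmem]
  · refine ⟨by tauto, ?_⟩
    rintro (rfl | hq)
    exacts [⟨h, .inl rfl⟩, ⟨hq.1, .inr hq.2⟩]
  · refine ⟨?_, by tauto⟩
    rintro ⟨hq, rfl | hlt⟩
    exacts [absurd hq h, ⟨hq, hlt⟩]

theorem run_forLoop_forLoop_induction {c c' : ℕ} (hn : s.reg 0 = n)
    (hp : (forLoop c (forLoop c' p)).WellFormed) {I : ℕ → State → Prop}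
    (h_setReg : ∀ k s x m, x ∈ ({c, c'} : Finset ℕ) → I k s → I k (s.setReg x m))
    (h_zero : I 0 s)
    (h_succ : ∀ (i j : Fin n) s', AgreeOff (insert c (insert c' p.regs)) p.arrs s s' →
      s'.reg c = i → s'.reg c' = j → I (i * n + j) s' → I (i * n + j + 1) (p.run s')) :
    I (n * n) ((forLoop c (forLoop c' p)).run s) := by
  have h0 : 0 ∉ insert c (insert c' p.regs) := hp.zero_notMem_regs
  have hc : c ∉ insert c' p.regs := hp.2.1
  have key := run_forLoop_induction (p := forLoop c' p) (s := s) (c := c)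
    (I := fun i s' => I (i * n) s') (by simpa using h_setReg _ _ _ _ (by simp) h_zero) ?_
  · rwa [hn] at key
  intro i hi s₁ hs₁ hi₁ hI₁
  have row := run_forLoop_induction (p := p) (s := s₁) (c := c')
    (I := fun j s' => I (i * n + j) s') (h_setReg _ _ _ _ (by simp) hI₁) ?_
  · rw [hs₁.reg 0 h0, hn, ← Nat.succ_mul] at row
    exact h_setReg _ _ _ _ (by simp) row
  intro j hj s₂ hs₂ hj₂ hI₂
  rw [hs₁.reg 0 h0] at hj
  exact h_setReg _ _ _ _ (by simp) (h_succ ⟨i, hn ▸ hi⟩ ⟨j, hn ▸ hj⟩ s₂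
    (hs₁.trans (hs₂.mono (subset_insert _ _) subset_rfl)) ((hs₂.reg c hc).trans hi₁) hj₂ hI₂)

theorem run_forPairs_induction {E : Finset (Fin n × Fin n)} (hn : s.reg 0 = n)
    (hp : (forPairs e p).WellFormed) (h3 : 3 ∉ p.regs) (he : DecidesPairs e p.regs p.arrs s E)
    {I : Finset (Fin n × Fin n) → State → Prop}
    (h_setReg : ∀ F s x m, x ∈ ({1, 2, 3} : Finset ℕ) → I F s → I F (s.setReg x m))
    (h_empty : I ∅ s)
    (h_insert : ∀ F (i j : Fin n) s', (i, j) ∉ F → s'.reg 2 = (j : ℕ) → I F s' →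
      I (insert (i, j) F) (p.run s')) :
    I E ((forPairs e p).run s) := by
  set before : ℕ → Finset (Fin n × Fin n) := fun k => {q ∈ E | (q.1 * n + q.2 : ℕ) < k}
    with hbefore
  have before_zero : before 0 = ∅ := by simp [hbefore]
  have before_end : before (n * n) = E := by
    refine filter_true_of_mem fun q _ => ?_
    simpa only [finProdFinEquiv_apply_val, mul_comm n, add_comm] using (finProdFinEquiv q).2
  have key := run_forLoop_forLoop_induction (s := s.setReg 3 0) (n := n) (by simpa using hn) hp.2
    (I := fun k s' => I (before k) s' ∧ s'.reg 3 = k)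
    (fun k s' x m hx h => ⟨h_setReg _ _ _ _ (by simp at hx ⊢; tauto) h.1, ?_⟩)
    ⟨h_setReg _ _ _ _ (by simp) (before_zero ▸ h_empty), by simp⟩ ?_
  · rw [before_end] at key
    exact key.1
  · rw [(agreeOff_setReg (A := ∅) hx s' m).reg 3 (by simp), h.2]
  rintro i j s' hs' hi hj ⟨hI, h⟩
  have hagree : AgreeOff (p.regs ∪ {1, 2, 3}) p.arrs s s' :=
    (agreeOff_setReg (by simp) s 0).trans (hs'.mono (by intro x; simp) (by simp))
  simp only [hbefore, filter_lt_succ, ← he s' i j hagree hi hj h, run_seq, run_ite, run_assign,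
    Expr.eval_add, Expr.eval_reg, Expr.eval_const]
  split_ifs
  · exact ⟨h_setReg _ _ _ _ (by simp) (h_insert _ i j _ (by simp) hj hI), by simp [reg_run h3, h]⟩
  · exact ⟨h_setReg _ _ _ _ (by simp) hI, by simp [h]⟩

end Loops

section Search

open ForProgram HyperbolicCut

variable {n : ℕ} {G : SimpleGraph (Fin n)} {s : State} {a b x r : ℕ} {e : Expr}

theorem isTrue_get_iff_mem {i : Fin n} (h : s.reg x = i) :
    (Expr.get a (.reg x)).IsTrue s ↔ i ∈ nodeSet n a s := by
  rw [mem_nodeSet, Expr.isTrue_get, Expr.eval_reg, h]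

theorem Encodes.isTrue_get_iff_adj (hs : Encodes G s) {i j : Fin n} (h : s.reg x = i * n + j) :
    (Expr.get 0 (.reg x)).IsTrue s ↔ G.Adj i j := by
  rw [← hs.adj, Expr.isTrue_get, Expr.eval_reg, h]

/-- Sets the register `x` to `m` times the number of pairs of nodes that satisfy the condition
`e`. -/
def tally (x : ℕ) (e : Expr) (m : ℕ) : ForProgram :=
  .seq (.assign x (.const 0)) (forPairs e (.assign x (.add (.reg x) (.const m))))

@[simp]
theorem regs_tally (x : ℕ) (e : Expr) (m : ℕ) : (tally x e m).regs = {1, 2, x, 3} := by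
  simp [tally]

@[simp]
theorem arrs_tally (x : ℕ) (e : Expr) (m : ℕ) : (tally x e m).arrs = ∅ := by
  simp [tally]

theorem wellFormed_tally (hx : 3 < x) (e : Expr) (m : ℕ) : (tally x e m).WellFormed := by
  simp [tally]
  omega

theorem reg_run_tally (hn : s.reg 0 = n) (hx : 3 < x) {E : Finset (Fin n × Fin n)}
    (he : DecidesPairs e {x} ∅ s E) (m : ℕ) : ((tally x e m).run s).reg x = m * #E := by
  refine run_forPairs_induction (s := s.setReg x 0) (by simpa [(Nat.zero_lt_of_lt hx).ne] using hn)
    (wellFormed_tally hx e m).2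
    (by simp; omega) (fun s' i j hs' => he s' i j ((agreeOff_setReg (by simp) s 0).trans hs'))
    (I := fun F s' => s'.reg x = m * #F) ?_ (by simp) ?_
  · intro F s' y k hy h
    rw [(agreeOff_setReg (A := ∅) hy s' k).reg x (by simp; omega), h]
  · intro F i j s' hij _ h
    simp [card_insert_of_notMem hij, h, mul_add]

/-- Replaces the set in the array `a` by its expansion that avoids the set in the array `b`. -/
def expandStep (a b : ℕ) : ForProgram :=
  .seq (fill 4 (.get a (.reg 4))) (.seq
    (forPairs (((Expr.get a (.reg 1)).and (.get 0 (.reg 3))).and (Expr.get b (.reg 2)).not)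
      (.store 4 (.reg 2) (.const 1)))
    (fill a (.get 4 (.reg 4))))

@[simp]
theorem regs_expandStep (a b : ℕ) : (expandStep a b).regs = {1, 2, 3, 4} := by
  simp [expandStep]

@[simp]
theorem arrs_expandStep (a b : ℕ) : (expandStep a b).arrs = {4, a} := by
  simp [expandStep]

@[simp]
theorem wellFormed_expandStep (a b : ℕ) : (expandStep a b).WellFormed := by
  simp [expandStep]

theorem nodeSet_run_fill_get (hn : s.reg 0 = n) (hab : a ≠ b) :
    nodeSet n b ((fill b (.get a (.reg 4))).run s) = nodeSet n a s :=
  nodeSet_run_fill hn fun i s' hs' hi => by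
    rw [isTrue_get_iff_mem hi, hs'.nodeSet_eq (by simpa using hab)]

theorem nodeSet_run_forPairs_store (hn : s.reg 0 = n) {E : Finset (Fin n × Fin n)}
    (he : DecidesPairs e ∅ {a} s E) :
    nodeSet n a ((forPairs e (.store a (.reg 2) (.const 1))).run s) =
      nodeSet n a s ∪ E.image Prod.snd := by
  refine run_forPairs_induction hn (by simp) (by simp) he
    (I := fun F s' => nodeSet n a s' = nodeSet n a s ∪ F.image Prod.snd) ?_ (by simp) ?_
  · intro F s' x _ _ h
    exact h
  · intro F i j s' _ hj h
    rw [image_insert, union_insert, ← h]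
    ext v
    simp only [run_store, mem_nodeSet, mem_insert, State.arr_setArr, Expr.eval_reg, hj,
      Expr.eval_const, Fin.ext_iff]
    split_ifs <;> simp_all

theorem nodeSet_run_expandStep (hs : Encodes G s) (ha : a ∉ ({0, 4} : Finset ℕ)) (hb : b ≠ 4) :
    nodeSet n a ((expandStep a b).run s) = expand G (nodeSet n b s) (nodeSet n a s) := by
  classical
  simp only [mem_insert, mem_singleton, not_or] at ha
  have hagree : AgreeOff {4} {4} s ((fill 4 (.get a (.reg 4))).run s) :=
    agreeOff_run (fill 4 _) s
  have hs₁ := hs.agreeOff hagree (by simp) (by simp)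
  rw [expandStep, run_seq, run_seq, nodeSet_run_fill_get _ (Ne.symm ha.2),
    nodeSet_run_forPairs_store (E := {q | (q.1 ∈ nodeSet n a s ∧ G.Adj q.1 q.2) ∧
      q.2 ∉ nodeSet n b s}) hs₁.size _, nodeSet_run_fill_get hs.size ha.2]
  · ext v
    simp [mem_expand]
    tauto
  · intro s' i j hs' hi hj hij
    have hE : Encodes G s' := hs₁.agreeOff hs' (by simp) (by simp)
    simp only [Expr.isTrue_and, Expr.isTrue_not, isTrue_get_iff_mem hi, isTrue_get_iff_mem hj,
      hE.isTrue_get_iff_adj hij, hs'.nodeSet_eq (mt mem_singleton.1 ha.2),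
      hs'.nodeSet_eq (mt mem_singleton.1 hb), hagree.nodeSet_eq (mt mem_singleton.1 ha.2),
      hagree.nodeSet_eq (mt mem_singleton.1 hb), mem_filter_univ]
  · rw [reg_run (by simp), hs₁.size]

/-- Repeats `expandStep a b` as often as the register `r` says, but at most as often as there are
nodes. -/
def expandIterate (a b r : ℕ) : ForProgram :=
  .forLoop 8 (.ite (.sub (.reg r) (.reg 8)) (expandStep a b) .skip)

@[simp]
theorem regs_expandIterate (a b r : ℕ) : (expandIterate a b r).regs = {8, 1, 2, 3, 4} := by
  simp [expandIterate]

@[simp]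
theorem arrs_expandIterate (a b r : ℕ) : (expandIterate a b r).arrs = {4, a} := by
  simp [expandIterate]

@[simp]
theorem wellFormed_expandIterate (a b r : ℕ) : (expandIterate a b r).WellFormed := by
  simp [expandIterate]

theorem nodeSet_run_expandIterate (hs : Encodes G s) (ha : a ∉ ({0, 4} : Finset ℕ))
    (hb : b ∉ ({4, a} : Finset ℕ)) (hr : r ∉ ({8, 1, 2, 3, 4} : Finset ℕ)) (hrn : s.reg r ≤ n) :
    nodeSet n a ((expandIterate a b r).run s) =
      (expand G (nodeSet n b s))^[s.reg r] (nodeSet n a s) := by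
  simp only [mem_insert, mem_singleton, not_or] at ha hb
  have key := run_forLoop_induction (c := 8) (s := s)
    (p := .ite (.sub (.reg r) (.reg 8)) (expandStep a b) .skip)
    (I := fun k s' =>
      nodeSet n a s' = (expand G (nodeSet n b s))^[min k (s.reg r)] (nodeSet n a s)) ?_ ?_
  · rwa [hs.size, min_eq_right hrn] at key
  · rw [Nat.zero_min]
    rfl
  · intro k _ s' hs' hk ih
    simp only [regs, arrs, regs_expandStep, arrs_expandStep, union_empty] at hs'
    have hE : Encodes G s' := hs.agreeOff hs' (by simp) (by simpa using Ne.symm ha.1)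
    simp only [(agreeOff_setReg (A := ∅) (mem_singleton_self 8) _ _).nodeSet_eq (notMem_empty _),
      run_ite, Expr.isTrue_sub, Expr.eval_reg, hk, hs'.reg r hr]
    split_ifs with hkr
    · rw [nodeSet_run_expandStep hE (by simpa using ha) hb.1, hs'.nodeSet_eq (by simpa using hb),
        ih, min_eq_left (Nat.succ_le_of_lt hkr), min_eq_left hkr.le, Function.iterate_succ_apply']
    · rw [run_skip, ih, min_eq_right (not_lt.1 hkr), min_eq_right (by omega)]

/-- Copies the set in the array `3` to the array `1` if it is sparse. -/
def keepIfSparse (K M : ℕ) : ForProgram :=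
  .seq (tally 5 ((Expr.get 3 (.reg 1)).and (.get 0 (.reg 3))) 1) <|
  .seq (tally 6 (((Expr.get 3 (.reg 1)).and (.get 0 (.reg 3))).and (Expr.get 3 (.reg 2)).not) M) <|
  .seq (tally 7 ((Expr.get 3 (.reg 1)).and ((Expr.reg 1).eq (.reg 2))) K) <|
  .ite ((Expr.reg 7).and (((Expr.reg 7).le (.reg 0)).and ((Expr.reg 6).le (.reg 5))))
    (fill 1 (.get 3 (.reg 4))) .skip

@[simp]
theorem regs_keepIfSparse (K M : ℕ) : (keepIfSparse K M).regs = {1, 2, 3, 4, 5, 6, 7} := by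
  simp only [keepIfSparse, regs, regs_tally, regs_fill, union_empty]
  decide

@[simp]
theorem arrs_keepIfSparse (K M : ℕ) : (keepIfSparse K M).arrs = {1} := by
  simp [keepIfSparse]

@[simp]
theorem wellFormed_keepIfSparse (K M : ℕ) : (keepIfSparse K M).WellFormed := by
  simp [keepIfSparse, wellFormed_tally]

theorem vol_eq_card_interedges {V : Type*} [Fintype V] (G : SimpleGraph V)
    [DecidableRel G.Adj] (S : Finset V) : vol G S = #(G.interedges S univ) := by
  classical
  simp only [vol, SimpleGraph.interedges_def, card_filter, sum_product,
    ← SimpleGraph.card_neighborFinset_eq_degree, SimpleGraph.neighborFinset_eq_filter]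

theorem reg_run_tally_vol [DecidableRel G.Adj] (hs : Encodes G s) (m : ℕ) :
    ((tally 5 ((Expr.get 3 (.reg 1)).and (.get 0 (.reg 3))) m).run s).reg 5 =
      m * vol G (nodeSet n 3 s) := by
  rw [vol_eq_card_interedges]
  refine reg_run_tally hs.size (by norm_num) (fun s' i j hs' hi _ hij => ?_) m
  have hE := hs.agreeOff hs' (by simp) (by simp)
  simp [isTrue_get_iff_mem hi, hE.isTrue_get_iff_adj hij, hs'.nodeSet_eq,
    SimpleGraph.mk_mem_interedges_iff]

theorem reg_run_tally_cutSize [DecidableRel G.Adj] (hs : Encodes G s) (m : ℕ) :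
    ((tally 6 (((Expr.get 3 (.reg 1)).and (.get 0 (.reg 3))).and (Expr.get 3 (.reg 2)).not) m).run
      s).reg 6 = m * cutSize G (nodeSet n 3 s) := by
  refine reg_run_tally hs.size (by norm_num) (fun s' i j hs' hi hj hij => ?_) m
  have hE := hs.agreeOff hs' (by simp) (by simp)
  simp only [Expr.isTrue_and, Expr.isTrue_not, isTrue_get_iff_mem hi, isTrue_get_iff_mem hj,
    hE.isTrue_get_iff_adj hij, hs'.nodeSet_eq (notMem_empty 3), SimpleGraph.mk_mem_interedges_iff,
    mem_compl]
  tauto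

theorem reg_run_tally_card (hn : s.reg 0 = n) (m : ℕ) :
    ((tally 7 ((Expr.get 3 (.reg 1)).and ((Expr.reg 1).eq (.reg 2))) m).run s).reg 7 =
      m * #(nodeSet n 3 s) := by
  rw [← diag_card]
  refine reg_run_tally hn (by norm_num) (fun s' i j hs' hi hj _ => ?_) m
  simp [isTrue_get_iff_mem hi, hi, hj, hs'.nodeSet_eq, Fin.ext_iff]

theorem isSparse_run_keepIfSparse [DecidableRel G.Adj] (hs : Encodes G s) {K M : ℕ} (hK : K ≠ 0)
    (h : IsSparse G K M (nodeSet n 3 s) ∨ IsSparse G K M (nodeSet n 1 s)) :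
    IsSparse G K M (nodeSet n 1 ((keepIfSparse K M).run s)) := by
  simp only [keepIfSparse, run_seq, run_ite]
  set s₁ := (tally 5 _ 1).run s with hs₁
  set s₂ := (tally 6 _ M).run s₁ with hs₂
  set s₃ := (tally 7 _ K).run s₂ with hs₃
  have hE₁ : Encodes G s₁ := hs.run (wellFormed_tally (by norm_num) _ _) (by simp)
  have hE₂ : Encodes G s₂ := hE₁.run (wellFormed_tally (by norm_num) _ _) (by simp)
  have hE₃ : Encodes G s₃ := hE₂.run (wellFormed_tally (by norm_num) _ _) (by simp)
  have hnode₁ (a : ℕ) : nodeSet n a s₁ = nodeSet n a s := nodeSet_run (by simp)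
  have hnode₂ (a : ℕ) : nodeSet n a s₂ = nodeSet n a s := (nodeSet_run (by simp)).trans (hnode₁ a)
  have hnode₃ (a : ℕ) : nodeSet n a s₃ = nodeSet n a s := (nodeSet_run (by simp)).trans (hnode₂ a)
  have hvol : s₃.reg 5 = vol G (nodeSet n 3 s) := by
    rw [hs₃, reg_run (by simp), hs₂, reg_run (by simp), hs₁, reg_run_tally_vol hs, one_mul]
  have hcut : s₃.reg 6 = M * cutSize G (nodeSet n 3 s) := by
    rw [hs₃, reg_run (by simp), hs₂, reg_run_tally_cutSize hE₁, hnode₁]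
  have hcard : s₃.reg 7 = K * #(nodeSet n 3 s) := by
    rw [hs₃, reg_run_tally_card hE₂.size, hnode₂]
  have htest : ((Expr.reg 7).and (((Expr.reg 7).le (.reg 0)).and
      ((Expr.reg 6).le (.reg 5)))).IsTrue s₃ ↔ IsSparse G K M (nodeSet n 3 s) := by
    simp [IsSparse, hvol, hcut, hcard, hE₃.size, hK, nonempty_iff_ne_empty]
  by_cases hsparse : IsSparse G K M (nodeSet n 3 s)
  · rwa [if_pos (htest.2 hsparse), nodeSet_run_fill_get hE₃.size (by norm_num), hnode₃]
  · rw [if_neg (mt htest.1 hsparse), run_skip, hnode₃]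
    exact h.resolve_left hsparse

/-- Writes to the array `3` the set `confinedSearch G x y p r k`, where the registers `9` to `13`
hold `x`, `y`, `r`, `p` and `k`. -/
def buildCandidate : ForProgram :=
  .seq (fill 5 (.const 0)) <|
  .seq (fill 2 (((Expr.reg 4).eq (.reg 9)).add ((Expr.reg 4).eq (.reg 10)))) <|
  .seq (expandIterate 2 5 11) <|
  .seq (fill 3 ((Expr.reg 4).eq (.reg 12))) (expandIterate 3 2 13)

@[simp]
theorem regs_buildCandidate : buildCandidate.regs = {1, 2, 3, 4, 8} := by
  simp only [buildCandidate, regs, regs_fill, regs_expandIterate]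
  decide

@[simp]
theorem arrs_buildCandidate : buildCandidate.arrs = {2, 3, 4, 5} := by
  simp only [buildCandidate, arrs, arrs_fill, arrs_expandIterate]
  decide

@[simp]
theorem wellFormed_buildCandidate : buildCandidate.WellFormed := by
  simp [buildCandidate]

theorem nodeSet_run_buildCandidate (hs : Encodes G s) {x y p : Fin n} {r k : ℕ}
    (hx : s.reg 9 = x) (hy : s.reg 10 = y) (hr : s.reg 11 = r) (hp : s.reg 12 = p)
    (hk : s.reg 13 = k) (hrn : r ≤ n) (hkn : k ≤ n) :
    nodeSet n 3 (buildCandidate.run s) = confinedSearch G x y p r k := by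
  simp only [buildCandidate, run_seq]
  set s₁ := (fill 5 _).run s
  set s₂ := (fill 2 _).run s₁ with hs₂
  set s₃ := (expandIterate 2 5 11).run s₂ with hs₃
  set s₄ := (fill 3 _).run s₃ with hs₄
  have hE₁ : Encodes G s₁ := hs.run (by simp) (by simp)
  have hE₂ : Encodes G s₂ := hE₁.run (by simp) (by simp)
  have hE₃ : Encodes G s₃ := hE₂.run (by simp) (by simp)
  have hE₄ : Encodes G s₄ := hE₃.run (by simp) (by simp)
  have hreg₁ (c : ℕ) (hc : 8 < c) : s₁.reg c = s.reg c := reg_run (by simp; omega)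
  have hreg₂ (c : ℕ) (hc : 8 < c) : s₂.reg c = s.reg c :=
    (reg_run (by simp; omega)).trans (hreg₁ c hc)
  have hreg₃ (c : ℕ) (hc : 8 < c) : s₃.reg c = s.reg c :=
    (reg_run (by simp; omega)).trans (hreg₂ c hc)
  have hreg₄ (c : ℕ) (hc : 8 < c) : s₄.reg c = s.reg c :=
    (reg_run (by simp; omega)).trans (hreg₃ c hc)
  have hempty : nodeSet n 5 s₂ = ∅ := by
    rw [hs₂, nodeSet_run (by simp)]
    exact nodeSet_run_fill hs.size (by simp)
  have hpair : nodeSet n 2 s₂ = {x, y} := nodeSet_run_fill hE₁.size fun i s' hs' hi => by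
    simp [hi, hs'.reg, hreg₁, hx, hy, Fin.ext_iff]
  have hball : nodeSet n 2 s₄ = (expand G ∅)^[r] {x, y} := by
    rw [hs₄, nodeSet_run (by simp), hs₃,
      nodeSet_run_expandIterate hE₂ (by simp) (by simp) (by simp), hempty, hpair,
      hreg₂ 11 (by simp), hr]
    simpa [hreg₂, hr] using hrn
  have hstart : nodeSet n 3 s₄ = {p} := nodeSet_run_fill hE₃.size fun i s' hs' hi => by
    simp [hi, hs'.reg, hreg₃, hp, Fin.ext_iff]
  rw [nodeSet_run_expandIterate hE₄ (by simp) (by simp) (by simp), hball, hstart,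
    hreg₄ 13 (by simp), hk, confinedSearch]
  simpa [hreg₄, hk] using hkn

/-- Runs `p` for all combinations of values below the number of nodes of the registers `cs`. -/
def nestedLoop (cs : List ℕ) (p : ForProgram) : ForProgram :=
  cs.foldr .forLoop p

@[simp]
theorem nestedLoop_nil (p : ForProgram) : nestedLoop [] p = p :=
  rfl

@[simp]
theorem nestedLoop_cons (c : ℕ) (cs : List ℕ) (p : ForProgram) :
    nestedLoop (c :: cs) p = .forLoop c (nestedLoop cs p) :=
  rfl

@[simp]
theorem arrs_nestedLoop (cs : List ℕ) (p : ForProgram) : (nestedLoop cs p).arrs = p.arrs := by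
  induction cs <;> simp_all

section NestedLoop

variable {p : ForProgram} {I F : State → Prop} {cs : List ℕ}

theorem run_nestedLoop_preserves
    (hI : ∀ s s', AgreeOff (nestedLoop cs p).regs p.arrs s s' → I s → I s')
    (hF : ∀ s x m, F s → F (s.setReg x m)) (hp : ∀ s, I s → F s → F (p.run s))
    (hIs : I s) (hFs : F s) : F ((nestedLoop cs p).run s) := by
  induction cs generalizing s with
  | nil => exact hp s hIs hFs
  | cons c cs ih =>
    refine run_forLoop_induction (p := nestedLoop cs p) (I := fun _ => F) (hF _ _ _ hFs)
      fun k _ s' hs' _ hFs' => ?_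
    rw [arrs_nestedLoop] at hs'
    exact hF _ _ _ (ih (fun t t' ht => hI t t' (ht.mono (subset_insert _ _) subset_rfl))
      (hI s s' hs' hIs) hFs')

theorem run_nestedLoop_establishes {v : List (ℕ × ℕ)}
    (hwf : (nestedLoop (v.map Prod.fst) p).WellFormed) (hv : ∀ q ∈ v, q.2 < n)
    (hI : ∀ s s', AgreeOff (nestedLoop (v.map Prod.fst) p).regs p.arrs s s' → I s → I s')
    (hF : ∀ s x m, F s → F (s.setReg x m)) (hp : ∀ s, I s → F s → F (p.run s))
    (hpv : ∀ s, I s → (∀ q ∈ v, s.reg q.1 = q.2) → F (p.run s))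
    (hn : s.reg 0 = n) (hIs : I s) : F ((nestedLoop (v.map Prod.fst) p).run s) := by
  induction v generalizing s I with
  | nil => exact hpv s hIs (by simp)
  | cons q v ih =>
    obtain ⟨c, m⟩ := q
    simp only [List.map_cons, nestedLoop_cons] at hwf hI ⊢
    have hI' : ∀ t t', AgreeOff (nestedLoop (v.map Prod.fst) p).regs p.arrs t t' → I t → I t' :=
      fun t t' ht => hI t t' (ht.mono (subset_insert _ _) subset_rfl)
    have hloop := run_forLoop_induction (s := s) (c := c) (p := nestedLoop (v.map Prod.fst) p)
      (I := fun k s' => m < k → F s') (by simp) ?_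
    · exact hloop (hn ▸ hv _ List.mem_cons_self)
    intro k _ s' hs' hk hFs' hmk
    rw [arrs_nestedLoop] at hs'
    have hIs' := hI s s' hs' hIs
    refine hF _ _ _ ?_
    rcases Nat.lt_succ_iff_lt_or_eq.1 hmk with hmk | rfl
    · exact run_nestedLoop_preserves hI' hF hp hIs' (hFs' hmk)
    · refine ih (I := fun t => I t ∧ t.reg c = m) hwf.2.2
        (fun q hq => hv q (List.mem_cons_of_mem _ hq))
        (fun t t' ht h => ⟨hI' t t' ht h.1, (ht.reg c hwf.2.1).trans h.2⟩)
        (fun t h => hp t h.1) (fun t h htv => hpv t h.1 (List.forall_mem_cons.2 ⟨h.2, htv⟩))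
        ((hs'.reg 0 hwf.zero_notMem_regs).trans hn) ⟨hIs', hk⟩

end NestedLoop

/-- Examines all the sets `confinedSearch G x y p r k`. -/
def search (K M : ℕ) : ForProgram :=
  nestedLoop [9, 10, 11, 12, 13] (.seq buildCandidate (keepIfSparse K M))

theorem wellFormed_search (K M : ℕ) : (search K M).WellFormed := by
  simp [search]

theorem isSparse_run_search [DecidableRel G.Adj] (hs : Encodes G s) {K M : ℕ} (hK : K ≠ 0)
    {x y p : Fin n} {r k : ℕ} (hr : r < n) (hk : k < n)
    (h : IsSparse G K M (confinedSearch G x y p r k)) :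
    IsSparse G K M (nodeSet n 1 ((search K M).run s)) := by
  have hbuild {s'} (hs' : Encodes G s') : Encodes G (buildCandidate.run s') :=
    hs'.run wellFormed_buildCandidate (by simp)
  refine run_nestedLoop_establishes (I := Encodes G)
    (F := fun s' => IsSparse G K M (nodeSet n 1 s'))
    (v := [(9, (x : ℕ)), (10, (y : ℕ)), (11, r), (12, (p : ℕ)), (13, k)]) (n := n)
    (wellFormed_search K M) (by simp [hr, hk])
    (fun t t' ht ht' => ht'.agreeOff ht (by simp) (by simp))
    (fun _ _ _ => id) (fun t ht hF => ?_) (fun t ht hv => ?_) hs.size hs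
  · refine isSparse_run_keepIfSparse (hbuild ht) hK (Or.inr ?_)
    rwa [nodeSet_run (by simp)]
  · simp only [List.forall_mem_cons] at hv
    obtain ⟨hx, hy, hr', hp, hk', -⟩ := hv
    refine isSparse_run_keepIfSparse (hbuild ht) hK (Or.inl ?_)
    rwa [nodeSet_run_buildCandidate ht hx hy hr' hp hk' hr.le hk.le]

end Search

section Tables

variable {n : ℕ}

theorem exists_isTrue_not_isTrue {s s' : State} (h : s ≠ s') :
    ∃ e : Expr, e.IsTrue s ∧ ¬e.IsTrue s' := by
  suffices ∃ e : Expr, e.eval s ≠ e.eval s' by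
    obtain ⟨e, he⟩ := this
    exact ⟨e.eq (.const (e.eval s)), by simp, by simpa using he.symm⟩
  contrapose! h
  obtain ⟨reg, arr⟩ := s
  obtain ⟨reg', arr'⟩ := s'
  congr
  · exact funext fun x => h (.reg x)
  · exact funext₂ fun a i => h (.get a (.const i))

theorem exists_isTrue_forall_not_isTrue {s : State} {T : Set State} (hT : T.Finite) (hs : s ∉ T) :
    ∃ e : Expr, e.IsTrue s ∧ ∀ s' ∈ T, ¬e.IsTrue s' := by
  induction T, hT using Set.Finite.induction_on with
  | empty => exact ⟨.const 1, by simp⟩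
  | insert _ _ ih =>
    rw [Set.mem_insert_iff, not_or] at hs
    obtain ⟨e, he, he'⟩ := exists_isTrue_not_isTrue hs.1
    obtain ⟨f, hf, hf'⟩ := ih hs.2
    refine ⟨e.and f, Expr.isTrue_and.2 ⟨he, hf⟩, Set.forall_mem_insert.2 ⟨?_, fun s' hs' => ?_⟩⟩
    · exact fun h => he' (Expr.isTrue_and.1 h).1
    · exact fun h => hf' s' hs' (Expr.isTrue_and.1 h).2

theorem exists_forProgram_of_finite {T : Set State} (hT : T.Finite) {Q : State → State → Prop}
    (h : ∀ s ∈ T, ∃ p : ForProgram, p.WellFormed ∧ Q s (p.run s)) :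
    ∃ p : ForProgram, p.WellFormed ∧ ∀ s ∈ T, Q s (p.run s) := by
  induction T, hT using Set.Finite.induction_on with
  | empty => exact ⟨.skip, trivial, by simp⟩
  | insert hs hT ih =>
    rw [Set.forall_mem_insert] at h
    obtain ⟨p, hp, hQ⟩ := h.1
    obtain ⟨q, hq, hQ'⟩ := ih h.2
    obtain ⟨e, he, he'⟩ := exists_isTrue_forall_not_isTrue hT hs
    refine ⟨.ite e p q, ⟨hp, hq⟩, Set.forall_mem_insert.2 ⟨?_, fun s hs => ?_⟩⟩
    · simpa [he] using hQ
    · simpa [he' s hs] using hQ' s hs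

theorem exists_isTrue_iff_reg_mem (x : ℕ) (A : Finset ℕ) :
    ∃ e : Expr, ∀ s, e.IsTrue s ↔ s.reg x ∈ A := by
  induction A using Finset.induction_on with
  | empty => exact ⟨.const 0, by simp⟩
  | insert a A _ ih =>
    obtain ⟨e, he⟩ := ih
    exact ⟨((Expr.reg x).eq (.const a)).add e, by simp [he]⟩

theorem exists_forProgram_output_eq (S : Finset (Fin n)) :
    ∃ p : ForProgram, p.WellFormed ∧ ∀ s, s.reg 0 = n → output n (p.run s) = S := by
  obtain ⟨e, he⟩ := exists_isTrue_iff_reg_mem 4 (S.map Fin.valEmbedding)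
  exact ⟨fill 1 e, wellFormed_fill 1 e, fun s hs => nodeSet_run_fill hs fun i s' _ hi => by
    simp [he, hi, Fin.val_inj]⟩

theorem Encodes.sigma_eq {m : ℕ} {G : SimpleGraph (Fin m)} {H : SimpleGraph (Fin n)} {s : State}
    (hG : Encodes G s) (hH : Encodes H s) : (⟨m, G⟩ : Σ n, SimpleGraph (Fin n)) = ⟨n, H⟩ := by
  obtain rfl : m = n := hG.size.symm.trans hH.size
  congr
  ext i j
  rw [← hG.adj, hH.adj]

theorem exists_forProgram_of_lt
    (R : ∀ {n : ℕ} (G : SimpleGraph (Fin n)) [DecidableRel G.Adj], Finset (Fin n) → Prop)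
    (n₀ : ℕ) :
    ∃ p : ForProgram, p.WellFormed ∧
      ∀ n < n₀, ∀ (G : SimpleGraph (Fin n)) [DecidableRel G.Adj], (∃ S, R G S) →
        R G (output n (p.run (input G))) := by
  classical
  let Q (s s' : State) : Prop := ∀ (n : ℕ) (G : SimpleGraph (Fin n)) [DecidableRel G.Adj],
    Encodes G s → (∃ S, R G S) → R G (output n s')
  let instances (q : Σ n : Fin n₀, SimpleGraph (Fin n)) : State := input q.2
  obtain ⟨p, hp, hQ⟩ := exists_forProgram_of_finite (Set.finite_range instances) (Q := Q) <| by
    rintro _ ⟨⟨m, H⟩, rfl⟩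
    by_cases hS : ∃ S, R H S
    · obtain ⟨S, hS⟩ := hS
      obtain ⟨p, hp, hout⟩ := exists_forProgram_output_eq S
      refine ⟨p, hp, fun n G _ hG _ => ?_⟩
      cases hG.sigma_eq (encodes_input H)
      rw [hout _ hG.size]
      convert hS
    · refine ⟨.skip, trivial, fun n G _ hG hS' => absurd ?_ hS⟩
      cases hG.sigma_eq (encodes_input H)
      convert hS'
  refine ⟨p, hp, fun n hn G _ hS => hQ _ ⟨⟨⟨n, hn⟩, G⟩, ?_⟩ n G (encodes_input G) hS⟩
  simp only [instances]
  congr!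

end Tables

theorem exists_ne_zero_one_le_mul {x : ℝ} (hx : 0 < x) : ∃ K : ℕ, K ≠ 0 ∧ 1 ≤ x * K := by
  obtain ⟨K, hK⟩ := exists_nat_gt (1 / x)
  have hKpos : (0 : ℝ) < K := (one_div_pos.2 hx).trans hK
  exact ⟨K, by exact_mod_cast hKpos.ne', ((div_lt_iff₀' hx).1 hK).le⟩

open HyperbolicCut in
theorem exists_forProgram_isSmallNonexpanding {α β ζ ε : ℝ} (hα : 0 ≤ α) (hβ : 0 ≤ β)
    (hαβ : 2 * α + β < 1) (hζ : 0 < ζ) (hε : 0 < ε) :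
    ∃ (p : ForProgram) (n₀ : ℕ), p.WellFormed ∧
      ∀ (n d : ℕ) (δ : ℝ) (G : SimpleGraph (Fin n)) [DecidableRel G.Adj],
        G.Connected → G.IsRegularOfDegree d → IsHyperbolic G δ →
        (d : ℝ) ≤ 2 ^ Real.logb 2 n ^ α → δ ≤ Real.logb 2 n ^ β →
        (n < n₀ → ∃ S : Finset (Fin n), IsSmallNonexpanding G ζ ε S) →
        IsSmallNonexpanding G ζ ε (output n (p.run (input G))) := by
  obtain ⟨K, hK, hζK⟩ := exists_ne_zero_one_le_mul hζ
  obtain ⟨M, hM, hεM⟩ := exists_ne_zero_one_le_mul hε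
  obtain ⟨n₀, hn₀⟩ := Filter.eventually_atTop.1 (exists_search_parameters hα hβ hαβ K M)
  obtain ⟨table, htable_wf, htable⟩ :=
    exists_forProgram_of_lt (fun G _ S => IsSmallNonexpanding G ζ ε S) n₀
  refine ⟨.ite (.sub (.const n₀) (.reg 0)) table (search K M), n₀,
    ⟨htable_wf, wellFormed_search K M⟩, fun n d δ G _ hG hd hδ hdn hδn hS => ?_⟩
  have hsize := (encodes_input G).size
  by_cases hn : n < n₀
  · simpa [hsize, hn] using htable n hn G (hS hn)
  · obtain ⟨N, r, t₀, t₁, w, hr, ht₀, ht₁, hT, hTn, hw, hdiam⟩ := hn₀ n (not_lt.1 hn) d hdn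
    have hNr : δ * (N + 3) ≤ r := le_trans (by gcongr) hr
    obtain ⟨x, y, p, r, hr, k, hk, hsparse⟩ := exists_isSparse_confinedSearch hG hd hδ hK hM hNr ht₀
      (by simpa using ht₁) hT (by simpa using hTn) hw (by simpa using hdiam)
    rw [Fintype.card_fin] at hr hk
    have hS' := (isSparse_run_search (encodes_input G) hK hr hk hsparse).isSmallNonexpanding
      hζK hεM hζ hε
    simpa [hsize, hn, output_eq_nodeSet] using hS'

end RAM

theorem lemma5_general {α β ζ ε : ℝ} (hα : 0 ≤ α) (hβ : 0 ≤ β) (hαβ : 2 * α + β < 1)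
    (hζ : 0 < ζ) (hε : 0 < ε) :
    ∃ (A : RAM.Program) (P : Polynomial ℕ) (n₀ : ℕ),
      ∀ (n d : ℕ) (δ : ℝ) (G : SimpleGraph (Fin n)) [DecidableRel G.Adj],
        G.Connected → G.IsRegularOfDegree d → IsHyperbolic G δ →
        (d : ℝ) ≤ (2 : ℝ) ^ ((Real.logb 2 n) ^ α) → δ ≤ (Real.logb 2 n) ^ β →
        (n < n₀ → ∃ S : Finset (Fin n), IsSmallNonexpanding G ζ ε S) →
        ∃ (t : ℕ) (s : RAM.State),
          RAM.Exec A (RAM.input G) t s ∧ t ≤ P.eval n ∧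
            IsSmallNonexpanding G ζ ε (RAM.output n s) := by
  obtain ⟨p, n₀, hwf, hp⟩ := RAM.exists_forProgram_isSmallNonexpanding hα hβ hαβ hζ hε
  refine ⟨p.toProgram, p.time, n₀, fun n d δ G _ hG hd hδ hdn hδn hS => ?_⟩
  obtain ⟨t, ht, hexec⟩ := RAM.ForProgram.exec_run hwf (RAM.input G)
  exact ⟨t, _, hexec, ht, hp n d δ G hG hd hδ hdn hδn hS⟩

theorem lemma5 :
    ∃ η : ℝ, 0 < η ∧
      ∀ ρ ζ ε : ℝ, 0 < ρ → ρ < 1 / 3 → 0 < ζ → ζ < 1 / 2 → 0 < ε → ε ≤ 1 →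
        ∃ (A : RAM.Program) (P : Polynomial ℕ),
          ∀ (n d : ℕ) (δ : ℝ) (G : SimpleGraph (Fin n)) [DecidableRel G.Adj],
            G.Connected → G.IsRegularOfDegree d → IsHyperbolic G δ →
            (d : ℝ) ≤ (2 : ℝ) ^ ((Real.logb 2 n) ^ (1 / 3 - ρ)) →
            δ ≤ (Real.logb 2 n) ^ ρ →
            (∃ S : Finset (Fin n), IsSmallNonexpanding G ζ ε S) →
            ∃ (t : ℕ) (s : RAM.State),
              RAM.Exec A (RAM.input G) t s ∧ t ≤ P.eval n ∧
                IsSmallNonexpanding G ζ (η * ε) (RAM.output n s) := by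
  refine ⟨1, one_pos, fun ρ ζ ε hρ hρ' hζ _ hε _ => ?_⟩
  obtain ⟨A, P, n₀, hA⟩ := lemma5_general (α := 1 / 3 - ρ) (β := ρ) (by linarith) hρ.le
    (by linarith) hζ hε
  refine ⟨A, P, fun n d δ G _ hG hd hδ hdn hδn hS => ?_⟩
  rw [one_mul]
  exact hA n d δ G hG hd hδ hdn hδn fun _ => hS
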